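/- All graphs are finite, simple and undirected. A graph $G$ is $B_0$-VPG if its vertices $v$ can be assigned paths $P_v$ of the two-dimensional grid $\mathbb{Z}\times\mathbb{Z}$, each of them horizontal or vertical (a single grid point being allowed), such that two distinct vertices $v,w$ are adjacent in $G$ if and only if $P_v$ and $P_w$ share a grid point. A graph is chordal if it has no induced cycle of length at least $4$, and diamond-free if it has no induced subgraph isomorphic to $K_4$ minus one edge. A cutpoint of a graph is a vertex whose removal increases the number of connected components; a block is a maximal connected subgraph that has no cutpoint of its own; an endblock is a block containing exactly one cutpoint of the graph; a $2$-cutpoint is a cutpoint that belongs to exactly two blocks, one of which is an endblock. The thin spider $N_n$ is the graph on $c_1,\dots,c_n,s_1,\dots,s_n$ in which the $c_i$ are pairwise adjacent, the $s_i$ are pairwise nonadjacent, and $s_i$ is adjacent to $c_j$ if and only if $i=j$. Let $\mathcal{F}$ be the family of graphs obtained (up to isomorphism) from $N_5$ by a finite, possibly empty, sequence of applications of the following procedure: choose in the current graph a complete subgraph $H$ on $4$ vertices and two distinct $2$-cutpoints $v_1,v_2\in H$, with endblocks $B_1\ni v_1$ and $B_2\ni v_2$; contract $v_1$ and $v_2$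 into a single vertex $x$; delete the vertices of $B_1\setminus\{v_1\}$ and $B_2\setminus\{v_2\}$; and add two disjoint copies of $N_3$, making $x$ adjacent to the vertices of the cliques $\{c_1,c_2,c_3\}$ of both copies. A graph is $\mathcal{F}$-free if no induced subgraph of it is isomorphic to a member of $\mathcal{F}$. **Theorem.** Let $G$ be a connected (in particular, non-empty) chordal diamond-free graph. Then $G$ is $B_0$-VPG if and only if $G$ is $\mathcal{F}$-free. -/

import Mathlib

namespace BlockVPG

universe u

/-! ### Grid representations -/

/-- The vertex set of a horizontal path of the grid `ℤ × ℤ`: finitely many (at least one)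
consecutive grid points of one row. A single grid point is allowed. -/
def IsHorizontalPath (P : Set (ℤ × ℤ)) : Prop :=
  ∃ y a b : ℤ, a ≤ b ∧ P = {p | p.2 = y ∧ a ≤ p.1 ∧ p.1 ≤ b}

/-- The vertex set of a vertical path of the grid `ℤ × ℤ`. -/
def IsVerticalPath (P : Set (ℤ × ℤ)) : Prop :=
  ∃ x a b : ℤ, a ≤ b ∧ P = {p | p.1 = x ∧ a ≤ p.2 ∧ p.2 ≤ b}

/-- `G` has a representation by horizontal and vertical grid paths: two distinct vertices are
adjacent exactly when their paths share a grid point. -/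
def IsB0VPG {V : Type u} (G : SimpleGraph V) : Prop :=
  ∃ P : V → Set (ℤ × ℤ),
    (∀ v, IsHorizontalPath (P v) ∨ IsVerticalPath (P v)) ∧
    ∀ v w, v ≠ w → (G.Adj v w ↔ (P v ∩ P w).Nonempty)

/-! ### Chordal and diamond-free graphs -/

/-- No induced (that is, chordless) cycle of length at least four. -/
def IsChordal {V : Type u} (G : SimpleGraph V) : Prop :=
  ∀ n : ℕ, 4 ≤ n → ¬ (SimpleGraph.cycleGraph n).IsIndContained G

/-- The diamond: `K₄` without the edge joining `0` and `1`. -/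
def diamond : SimpleGraph (Fin 4) :=
  (⊤ : SimpleGraph (Fin 4)).deleteEdges {s(0, 1)}

/-- No induced diamond. -/
def IsDiamondFree {V : Type u} (G : SimpleGraph V) : Prop :=
  ¬ diamond.IsIndContained G

/-! ### Cutpoints and blocks (of finite graphs) -/

/-- Removing `v` increases the number of connected components. -/
def IsCutpoint {V : Type u} (G : SimpleGraph V) (v : V) : Prop :=
  Nat.card G.ConnectedComponent < Nat.card (G.induce ({v}ᶜ : Set V)).ConnectedComponent

/-- A block, given by its vertex set: a maximal set of vertices inducing a connected subgraph
that has no cutpoint of its own. -/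
def IsBlock {V : Type u} (G : SimpleGraph V) (B : Set V) : Prop :=
  Maximal (fun S : Set V =>
    (G.induce S).Connected ∧ ∀ v : S, ¬ IsCutpoint (G.induce S) v) B

/-- An endblock: a block containing exactly one cutpoint of the graph. -/
def IsEndblock {V : Type u} (G : SimpleGraph V) (B : Set V) : Prop :=
  IsBlock G B ∧ ∃! v, v ∈ B ∧ IsCutpoint G v

/-- A 2-cutpoint: a cutpoint belonging to exactly two blocks, one of which is an endblock. -/
def IsTwoCutpoint {V : Type u} (G : SimpleGraph V) (v : V) : Prop :=
  IsCutpoint G v ∧ {B : Set V | IsBlock G B ∧ v ∈ B}.ncard = 2 ∧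
    ∃ B : Set V, IsEndblock G B ∧ v ∈ B

/-! ### Thin spiders and the family `𝓕` -/

/-- The thin spider of size `n`: a clique `Sum.inl 0, …, Sum.inl (n - 1)`, and an independent set
`Sum.inr 0, …, Sum.inr (n - 1)`, where `Sum.inr i` is adjacent to `Sum.inl j` iff `i = j`. -/
def thinSpider (n : ℕ) : SimpleGraph (Fin n ⊕ Fin n) :=
  SimpleGraph.fromRel fun a b =>
    match a, b with
    | Sum.inl _, Sum.inl _ => True
    | Sum.inl i, Sum.inr j => i = j
    | _, _ => False

/-- The vertices after one application of the procedure: the vertices outside the two endblocks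
`B₁` and `B₂` (in particular neither contracted vertex), the new vertex `x`, and the vertices of
two disjoint thin spiders of size 3, indexed by `Bool`. -/
inductive StepVertex {W : Type} (B₁ B₂ : Set W) : Type
  | old (w : W) (h : w ∉ B₁ ∪ B₂) : StepVertex B₁ B₂
  | x : StepVertex B₁ B₂
  | spider (i : Bool) (s : Fin 3 ⊕ Fin 3) : StepVertex B₁ B₂

/-- The procedure: contract `v₁` and `v₂` to the single vertex `x`, delete the other vertices
of `B₁` and `B₂`, and add two thin spiders of size 3 with `x` adjacent to the vertices of the
cliques of both. -/
def step {W : Type} (G : SimpleGraph W) (v₁ v₂ : W) (B₁ B₂ : Set W) :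
    SimpleGraph (StepVertex B₁ B₂) :=
  SimpleGraph.fromRel fun a b =>
    match a, b with
    | .old w _, .old w' _ => G.Adj w w'
    | .old w _, .x => G.Adj w v₁ ∨ G.Adj w v₂
    | .x, .spider _ (Sum.inl _) => True
    | .spider i s, .spider j t => i = j ∧ (thinSpider 3).Adj s t
    | _, _ => False

/-- The graphs obtained from the thin spider of size 5 by finitely many applications of the
procedure, applied to two distinct 2-cutpoints `v₁`, `v₂` (with endblocks `B₁`, `B₂`) of a complete
subgraph `H` with four vertices. (One graph of each isomorphism type would be enough, since the
family is only used through induced containment.) -/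
inductive FamilyF : {W : Type} → SimpleGraph W → Prop
  | base : FamilyF (thinSpider 5)
  | step {W : Type} {G : SimpleGraph W} (hG : FamilyF G)
      (H : Finset W) (hH : G.IsNClique 4 H)
      (v₁ v₂ : W) (hv : v₁ ≠ v₂) (hv₁H : v₁ ∈ H) (hv₂H : v₂ ∈ H)
      (hv₁ : IsTwoCutpoint G v₁) (hv₂ : IsTwoCutpoint G v₂)
      (B₁ B₂ : Set W) (hB₁ : IsEndblock G B₁) (hB₂ : IsEndblock G B₂)
      (hvB₁ : v₁ ∈ B₁) (hvB₂ : v₂ ∈ B₂) :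
      FamilyF (BlockVPG.step G v₁ v₂ B₁ B₂)

/-- `G` has no induced subgraph isomorphic to a member of `𝓕`. -/
def IsFFree {V : Type u} (G : SimpleGraph V) : Prop :=
  ∀ (W : Type) (F : SimpleGraph W), FamilyF F → ¬ F.IsIndContained G

end BlockVPG

/-!
A finite connected chordal diamond-free graph is a block graph: two neighbours of a vertex `v` that
are still connected after the removal of `v` are equal or adjacent (`locSep_of_isChordal`). All
arguments below use this property, `LocSep`, in place of the two hypotheses. Grid paths are treated
as segments with coordinates in a linear order, where meeting is a matter of order comparisons.

In a representation, the paths of a complete block share a point (Helly). Of the paths through this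
point that have neighbours outside the block, each needs one of the four directions at the point for
itself, and a path on which the points of other blocks lie on both sides needs two opposite ones.

*Necessity.* Five directions are not available, so the thin spider of size five has no
representation. The procedure can be undone on representations (`StepData.exists_rep`): the two new
copies of `N₃` at the vertex `x` cannot be passed by the path of `x`, so the old clique at `x` lies
between them, and the path of `x` can be cut there into paths for the two contracted vertices. That
the procedure is applied to a block graph, where blocks are cliques meeting in at most one vertex,
is carried along the induction (`FamilyF.finBlockGraph`).

*Sufficiency.* The vertices hanging at a vertex `a` of a block away from that block are drawn along
the path of `a`. A branch at `a` is a component of the graph without `a`; it is attached either in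
the middle of the path of `a` (`RepMid`) or at one of its two ends (`RepEnd`). Counting the
directions that the other vertices of the block need, zero, one or two each, a branch can be
attached in the middle if the count is at most two and at an end if it is three. In the second case
the branch contains a branch of the recursive shape `BranchTree`, and three such branches at one
vertex form a member of the family (`inFamily`), as does a count of four or more. The recursion is
`attachable`, and the drawing of a block together with everything attached to it is
`exists_rep_of_arms`; coordinates are rational, and only their order matters
(`isB0VPG_of_isRep_rat`).
-/

namespace BlockVPG

universe u

section

variable {V : Type u} {G : SimpleGraph V}

/-! ### Connectivity after the removal of a vertex -/

/-- Adjacent-or-equal is forced between neighbours of `v` that remain connected when `v` is removed.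
For a connected graph this says that `G` is a block graph (every block is complete). Removal of `v`
is encoded by isolating `v`, which keeps the vertex type. -/
def LocSep (G : SimpleGraph V) : Prop :=
  ∀ v a b, G.Adj v a → G.Adj v b → (G.deleteIncidenceSet v).Reachable a b → a = b ∨ G.Adj a b

theorem reachable_induce_iff {S : Set V} {a b : S} :
    (G.induce S).Reachable a b ↔
      Relation.ReflTransGen (fun p q : V => G.Adj p q ∧ p ∈ S ∧ q ∈ S) a b := by
  rw [SimpleGraph.reachable_iff_reflTransGen]
  constructor
  · intro h
    exact Relation.ReflTransGen.lift (p := fun p q : V => G.Adj p q ∧ p ∈ S ∧ q ∈ S)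
      (fun x : S => (x : V)) (fun p q hpq => ⟨hpq, p.2, q.2⟩) _ _ h
  · intro h
    obtain ⟨b, hb⟩ := b
    change Relation.ReflTransGen _ _ b at h
    induction h with
    | refl => exact .refl
    | tail _ h2 ih => exact (ih h2.2.1).tail h2.1

theorem reachable_delete_iff {v a b : V} (ha : a ≠ v) (hb : b ≠ v) :
    (G.induce ({v}ᶜ : Set V)).Reachable ⟨a, ha⟩ ⟨b, hb⟩ ↔
      (G.deleteIncidenceSet v).Reachable a b := by
  rw [reachable_induce_iff, SimpleGraph.reachable_iff_reflTransGen]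
  constructor <;> intro h
  · exact Relation.ReflTransGen.mono
      (fun p q hpq => SimpleGraph.deleteIncidenceSet_adj.2 hpq) _ _ h
  · exact Relation.ReflTransGen.mono
      (fun p q hpq => SimpleGraph.deleteIncidenceSet_adj.1 hpq) _ _ h

theorem preconnected_induce_diff_iff {S : Set V} (v : S) :
    ((G.induce S).induce ({v}ᶜ : Set S)).Preconnected ↔ (G.induce (S \ {(v : V)})).Preconnected := by
  let e : ((G.induce S).induce ({v}ᶜ : Set S)) ≃g (G.induce (S \ {(v : V)})) :=
    { toFun := fun x => ⟨x.1.1, x.1.2, fun h => x.2 (Subtype.ext h)⟩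
      invFun := fun x => ⟨⟨x.1, x.2.1⟩, fun h => x.2.2 (congrArg Subtype.val h)⟩
      left_inv := fun _ => rfl
      right_inv := fun _ => rfl
      map_rel_iff' := Iff.rfl }
  exact e.preconnected_iff

theorem preconnected_iff_card_le {H : SimpleGraph V} [Finite V] :
    H.Preconnected ↔ Nat.card H.ConnectedComponent ≤ 1 := by
  rw [Finite.card_le_one_iff_subsingleton]
  exact ⟨fun h => h.subsingleton_connectedComponent, fun h a b =>
    SimpleGraph.ConnectedComponent.exact (h.elim _ _)⟩

theorem not_isCutpoint_iff [Finite V] (hG : G.Connected) (v : V) :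
    ¬ IsCutpoint G v ↔ (G.induce ({v}ᶜ : Set V)).Preconnected := by
  have : Nat.card G.ConnectedComponent = 1 := by
    have h1 := preconnected_iff_card_le.1 hG.preconnected
    have := hG.nonempty
    have : 0 < Nat.card G.ConnectedComponent := Nat.card_pos
    omega
  rw [IsCutpoint, this, preconnected_iff_card_le, not_lt]

theorem isCutpoint_of_not_reachable [Finite V] (hG : G.Connected) {v a b : V} (ha : a ≠ v)
    (hb : b ≠ v) (h : ¬ (G.deleteIncidenceSet v).Reachable a b) : IsCutpoint G v := by
  by_contra hc
  exact h ((reachable_delete_iff ha hb).1 ((not_isCutpoint_iff hG v).1 hc _ _))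

/-! ### Nonseparable sets and blocks -/

/-- A vertex set inducing a connected graph without a cutpoint of its own. -/
def Nonsep (G : SimpleGraph V) (S : Set V) : Prop :=
  S.Nonempty ∧ (G.induce S).Preconnected ∧ ∀ v ∈ S, (G.induce (S \ {v})).Preconnected

theorem nonsep_iff [Finite V] {S : Set V} :
    ((G.induce S).Connected ∧ ∀ v : S, ¬ IsCutpoint (G.induce S) v) ↔ Nonsep G S := by
  constructor
  · rintro ⟨h, h'⟩
    refine ⟨Set.nonempty_coe_sort.1 h.nonempty, h.preconnected, fun v hv => ?_⟩
    exact (preconnected_induce_diff_iff ⟨v, hv⟩).1 ((not_isCutpoint_iff h _).1 (h' ⟨v, hv⟩))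
  · rintro ⟨h1, h2, h3⟩
    have : Nonempty S := h1.to_subtype
    have h : (G.induce S).Connected := ⟨h2⟩
    exact ⟨h, fun v => (not_isCutpoint_iff h v).2 ((preconnected_induce_diff_iff v).2 (h3 v v.2))⟩

theorem isBlock_iff [Finite V] {B : Set V} : IsBlock G B ↔ Maximal (Nonsep G) B := by
  unfold IsBlock
  simp only [nonsep_iff]

theorem Nonsep.diff_preconnected {S : Set V} (h : Nonsep G S) (v : V) :
    (G.induce (S \ {v})).Preconnected := by
  by_cases hv : v ∈ S
  · exact h.2.2 v hv
  · rw [Set.sdiff_singleton_eq_self hv]; exact h.2.1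

theorem Nonsep.union {S T : Set V} (hS : Nonsep G S) (hT : Nonsep G T) {a b : V} (hab : a ≠ b)
    (ha : a ∈ S ∩ T) (hb : b ∈ S ∩ T) : Nonsep G (S ∪ T) := by
  refine ⟨hS.1.inl, (SimpleGraph.induce_union_connected hS.2.1 hT.2.1 ⟨a, ha⟩).preconnected,
    fun v _ => ?_⟩
  rw [Set.union_sdiff_distrib]
  refine (SimpleGraph.induce_union_connected (hS.diff_preconnected v)
    (hT.diff_preconnected v) ?_).preconnected
  by_cases h : a = v
  · exact ⟨b, ⟨hb.1, fun h' => hab (h.trans h'.symm)⟩, ⟨hb.2, fun h' => hab (h.trans h'.symm)⟩⟩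
  · exact ⟨a, ⟨ha.1, h⟩, ⟨ha.2, h⟩⟩

theorem preconnected_induce_of_isClique {S : Set V} (h : G.IsClique S) :
    (G.induce S).Preconnected := by
  intro a b
  by_cases hab : a = b
  · exact hab ▸ .rfl
  · exact SimpleGraph.Adj.reachable (h a.2 b.2 fun h' => hab (Subtype.ext h'))

theorem Nonsep.of_isClique {S : Set V} (h : G.IsClique S) (hS : S.Nonempty) : Nonsep G S :=
  ⟨hS, preconnected_induce_of_isClique h,
    fun _ _ => preconnected_induce_of_isClique (h.subset Set.sdiff_subset)⟩

theorem Nonsep.exists_isBlock [Finite V] {S : Set V} (h : Nonsep G S) :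
    ∃ B, IsBlock G B ∧ S ⊆ B := by
  obtain ⟨B, hSB, hB⟩ := (Set.toFinite {T : Set V | Nonsep G T}).exists_le_maximal h
  exact ⟨B, isBlock_iff.2 hB, hSB⟩

theorem IsBlock.subset_of_nonsep [Finite V] {B T : Set V} (hB : IsBlock G B) (hT : Nonsep G T)
    {a b : V} (hab : a ≠ b) (ha : a ∈ B ∩ T) (hb : b ∈ B ∩ T) : T ⊆ B := by
  rw [isBlock_iff] at hB
  exact Set.subset_union_right.trans
    (hB.le_of_ge (hB.prop.union hT hab ha hb) Set.subset_union_left)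

theorem IsBlock.nonsep [Finite V] {B : Set V} (hB : IsBlock G B) : Nonsep G B :=
  (isBlock_iff.1 hB).prop

theorem IsBlock.eq_of_two_mem [Finite V] {B B' : Set V} (hB : IsBlock G B) (hB' : IsBlock G B')
    {a b : V} (hab : a ≠ b) (ha : a ∈ B ∩ B') (hb : b ∈ B ∩ B') : B = B' :=
  (hB'.subset_of_nonsep hB.nonsep hab ha.symm hb.symm).antisymm
    (hB.subset_of_nonsep hB'.nonsep hab ha hb)

/-- Two distinct vertices of a nonseparable set are adjacent in a block graph: on a path of the set,
three consecutive vertices `a, c, d` satisfy `a = d` or `a ∼ d`, because `c` does not separate `a`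
from `d`. -/
theorem Nonsep.isClique {S : Set V} (hS : Nonsep G S) (hG : LocSep G) : G.IsClique S := by
  intro a ha b hb hab
  have h := reachable_induce_iff.1 (hS.2.1 ⟨a, ha⟩ ⟨b, hb⟩)
  simp only at h
  suffices h : b = a ∨ G.Adj a b from h.resolve_left hab.symm
  clear hab
  induction h with
  | refl => exact .inl rfl
  | @tail c d _ h2 ih =>
    obtain ⟨hcd, hc, hd⟩ := h2
    rcases ih hc with rfl | hac
    · exact .inr hcd
    by_cases hdc : d = a
    · exact .inl hdc
    refine (hG c a d hac.symm hcd ?_).imp Eq.symm id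
    have h3 := hS.2.2 c hc ⟨a, ha, hac.ne⟩ ⟨d, hd, hcd.ne'⟩
    rw [reachable_induce_iff] at h3
    rw [SimpleGraph.reachable_iff_reflTransGen]
    exact Relation.ReflTransGen.mono (fun p q hpq =>
      SimpleGraph.deleteIncidenceSet_adj.2 ⟨hpq.1, hpq.2.1.2, hpq.2.2.2⟩) _ _ h3

theorem IsBlock.isClique [Finite V] {B : Set V} (hB : IsBlock G B) (hG : LocSep G) :
    G.IsClique B := hB.nonsep.isClique hG

theorem exists_isBlock_of_adj [Finite V] {a b : V} (h : G.Adj a b) :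
    ∃ B, IsBlock G B ∧ a ∈ B ∧ b ∈ B := by
  obtain ⟨B, hB, hs⟩ := (Nonsep.of_isClique (G := G) (S := {a, b})
    (SimpleGraph.isClique_pair.2 fun _ => h) ⟨a, by simp⟩).exists_isBlock
  exact ⟨B, hB, hs (by simp), hs (by simp)⟩

end

section

variable {V : Type u} {G : SimpleGraph V}

/-! ### Axis-parallel segments over a linear order -/

/-- An axis-parallel segment `[a, b] × [c, d]`, one of whose sides is a point. -/
structure Seg (α : Type*) [LinearOrder α] where
  a : α
  b : α
  c : α
  d : α
  hab : a ≤ b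
  hcd : c ≤ d
  thin : a = b ∨ c = d

namespace Seg

variable {α : Type*} [LinearOrder α]

/-- The point `(x, y)` lies on the segment. -/
def Has (s : Seg α) (x y : α) : Prop := s.a ≤ x ∧ x ≤ s.b ∧ s.c ≤ y ∧ y ≤ s.d

/-- Two segments share a point. The encoding by order comparisons of coordinates makes it plain that
strictly monotone changes of coordinates do not matter. -/
def Meets (s t : Seg α) : Prop := s.a ≤ t.b ∧ t.a ≤ s.b ∧ s.c ≤ t.d ∧ t.c ≤ s.d

theorem meets_iff {s t : Seg α} : s.Meets t ↔ ∃ x y, s.Has x y ∧ t.Has x y := by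
  constructor
  · rintro ⟨h1, h2, h3, h4⟩
    exact ⟨max s.a t.a, max s.c t.c,
      ⟨le_max_left _ _, max_le s.hab h2, le_max_left _ _, max_le s.hcd h4⟩,
      ⟨le_max_right _ _, max_le h1 t.hab, le_max_right _ _, max_le h3 t.hcd⟩⟩
  · rintro ⟨x, y, ⟨h1, h2, h3, h4⟩, ⟨h5, h6, h7, h8⟩⟩
    exact ⟨h1.trans h6, h5.trans h2, h3.trans h8, h7.trans h4⟩

theorem Meets.symm {s t : Seg α} (h : s.Meets t) : t.Meets s := ⟨h.2.1, h.1, h.2.2.2, h.2.2.1⟩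

theorem meets_comm {s t : Seg α} : s.Meets t ↔ t.Meets s := ⟨Meets.symm, Meets.symm⟩

theorem meets_self (s : Seg α) : s.Meets s := ⟨s.hab, s.hab, s.hcd, s.hcd⟩

/-- Reflection in the diagonal. -/
def swap (s : Seg α) : Seg α := ⟨s.c, s.d, s.a, s.b, s.hcd, s.hab, s.thin.symm⟩

theorem swap_meets {s t : Seg α} : s.swap.Meets t.swap ↔ s.Meets t :=
  ⟨fun h => ⟨h.2.2.1, h.2.2.2, h.1, h.2.1⟩, fun h => ⟨h.2.2.1, h.2.2.2, h.1, h.2.1⟩⟩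

/-- The segment consisting of one point. -/
def point (x y : α) : Seg α := ⟨x, x, y, y, le_rfl, le_rfl, .inl rfl⟩

theorem point_meets {x y : α} {s : Seg α} : (point x y).Meets s ↔ s.Has x y :=
  ⟨fun h => ⟨h.2.1, h.1, h.2.2.2, h.2.2.1⟩, fun h => ⟨h.2.1, h.1, h.2.2.2, h.2.2.1⟩⟩

/-- A horizontal segment with given endpoints, in either order. -/
def hseg (x x' y : α) : Seg α :=
  ⟨min x x', max x x', y, y, min_le_max, le_rfl, .inr rfl⟩

/-- The segment as a set of points. -/
def pts (s : Seg α) : Set (α × α) := {p | s.Has p.1 p.2}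

end Seg

/-- A family of segments whose intersection graph is `G`. -/
def IsRep {α : Type*} [LinearOrder α] (G : SimpleGraph V) (R : V → Seg α) : Prop :=
  ∀ v w, v ≠ w → (G.Adj v w ↔ (R v).Meets (R w))

theorem IsRep.swap {α : Type*} [LinearOrder α] {R : V → Seg α} (h : IsRep G R) :
    IsRep G fun v => (R v).swap :=
  fun v w hvw => (h v w hvw).trans Seg.swap_meets.symm

theorem isPath_iff (P : Set (ℤ × ℤ)) :
    (IsHorizontalPath P ∨ IsVerticalPath P) ↔ ∃ s : Seg ℤ, P = s.pts := by
  constructor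
  · rintro (⟨y, a, b, h, rfl⟩ | ⟨x, a, b, h, rfl⟩)
    · refine ⟨⟨a, b, y, y, h, le_rfl, .inr rfl⟩, ?_⟩
      ext p
      simp only [Seg.pts, Seg.Has, Set.mem_ofPred_eq]
      omega
    · refine ⟨⟨x, x, a, b, le_rfl, h, .inl rfl⟩, ?_⟩
      ext p
      simp only [Seg.pts, Seg.Has, Set.mem_ofPred_eq]
      omega
  · rintro ⟨⟨a, b, c, d, hab, hcd, h⟩, rfl⟩
    rcases h with h | h
    · refine .inr ⟨a, c, d, hcd, ?_⟩
      ext p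
      simp only [Seg.pts, Seg.Has, Set.mem_ofPred_eq]
      omega
    · refine .inl ⟨c, a, b, hab, ?_⟩
      ext p
      simp only [Seg.pts, Seg.Has, Set.mem_ofPred_eq]
      omega

theorem isB0VPG_iff : IsB0VPG G ↔ ∃ R : V → Seg ℤ, IsRep G R := by
  have key : ∀ s t : Seg ℤ, s.Meets t ↔ (s.pts ∩ t.pts).Nonempty := fun s t => by
    rw [Seg.meets_iff]
    exact ⟨fun ⟨x, y, h⟩ => ⟨(x, y), h⟩, fun ⟨p, h⟩ => ⟨p.1, p.2, h⟩⟩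
  constructor
  · rintro ⟨P, h1, h2⟩
    choose R hR using fun v => (isPath_iff (P v)).1 (h1 v)
    exact ⟨R, fun v w hvw => by rw [h2 v w hvw, hR v, hR w, key]⟩
  · rintro ⟨R, hR⟩
    exact ⟨fun v => (R v).pts, fun v => (isPath_iff _).2 ⟨R v, rfl⟩,
      fun v w hvw => (hR v w hvw).trans (key _ _)⟩

theorem IsRep.comp_embedding {α : Type*} [LinearOrder α] {W : Type*} {F : SimpleGraph W}
    {R : V → Seg α} (h : IsRep G R) (f : F ↪g G) : IsRep F (R ∘ f) :=
  fun _ _ hvw => f.map_adj_iff.symm.trans (h _ _ (f.injective.ne hvw))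

/-! ### Cliques of segments -/

section Cliques

variable {α : Type*} [LinearOrder α]

/-- Helly's theorem for pairwise intersecting segments. -/
theorem exists_common_point {ι : Type*} [Finite ι] [Nonempty ι] (R : ι → Seg α)
    (h : ∀ i j, (R i).Meets (R j)) : ∃ x y, ∀ i, (R i).Has x y := by
  obtain ⟨i, hi⟩ := Finite.exists_max fun i => (R i).a
  obtain ⟨j, hj⟩ := Finite.exists_max fun i => (R i).c
  exact ⟨(R i).a, (R j).c, fun k => ⟨hi k, (h i k).1, hj k, (h j k).2.2.1⟩⟩

/-- Of three intervals with a common point, one is covered by the two others. Hence no three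
collinear segments through one point can each be met by a segment that avoids the two others. -/
theorem card_lt_three_of_collinear {ι : Type*} (R S : ι → Seg α) (T : Finset ι) {x y : α}
    (hq : ∀ i ∈ T, (R i).Has x y) (hR : ∀ i ∈ T, (R i).c = (R i).d)
    (hS : ∀ i ∈ T, ∀ j ∈ T, (S i).Meets (R j) ↔ i = j) : T.card < 3 := by
  classical
  by_contra! hT
  have hne : T.Nonempty := Finset.card_pos.1 (by omega)
  obtain ⟨j, hj, hj'⟩ := T.exists_min_image (fun i => (R i).a) hne
  obtain ⟨k, hk, hk'⟩ := T.exists_max_image (fun i => (R i).b) hne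
  obtain ⟨i, hi, hijk⟩ := Finset.exists_mem_notMem_of_card_lt_card
    (s := {j, k}) (t := T) (Finset.card_le_two.trans_lt hT)
  simp only [Finset.mem_insert, Finset.mem_singleton, not_or] at hijk
  obtain ⟨p, q, hp, hp'⟩ := Seg.meets_iff.1 ((hS i hi i hi).2 rfl)
  have hi1 := hq i hi
  have hj1 := hq j hj
  have hk1 := hq k hk
  have e1 := hR i hi
  have e2 := hR j hj
  have e3 := hR k hk
  have hqy : q = y := le_antisymm (hp'.2.2.2.trans (e1 ▸ hi1.2.2.1))
    (hi1.2.2.2.trans (e1 ▸ hp'.2.2.1))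
  subst hqy
  rcases le_total p x with h | h
  · exact hijk.1 ((hS i hi j hj).1 (Seg.meets_iff.2
      ⟨p, q, hp, (hj' i hi).trans hp'.1, h.trans hj1.2.1, hj1.2.2⟩))
  · exact hijk.2 ((hS i hi k hk).1 (Seg.meets_iff.2
      ⟨p, q, hp, hk1.1.trans h, hp'.2.1.trans (hk' i hi), hk1.2.2⟩))

end Cliques

/-! ### Thin spiders -/

@[simp] theorem thinSpider_inl_inl {n : ℕ} (i j : Fin n) :
    (thinSpider n).Adj (.inl i) (.inl j) ↔ i ≠ j := by
  simp [thinSpider]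

@[simp] theorem thinSpider_inl_inr {n : ℕ} (i j : Fin n) :
    (thinSpider n).Adj (.inl i) (.inr j) ↔ i = j := by
  simp [thinSpider]

@[simp] theorem thinSpider_inr_inl {n : ℕ} (i j : Fin n) :
    (thinSpider n).Adj (.inr i) (.inl j) ↔ i = j := by
  simp [thinSpider, eq_comm]

@[simp] theorem thinSpider_inr_inr {n : ℕ} (i j : Fin n) :
    ¬ (thinSpider n).Adj (.inr i) (.inr j) := by
  simp [thinSpider]

/-- Among the five clique vertices of the thin spider, three are represented by collinear paths. -/
theorem thinSpider_five_not_rep (R : Fin 5 ⊕ Fin 5 → Seg ℤ) : ¬ IsRep (thinSpider 5) R := by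
  intro hR
  obtain ⟨x, y, hq⟩ := exists_common_point (fun i => R (Sum.inl i)) fun i j => by
    by_cases h : i = j
    · exact h ▸ Seg.meets_self _
    · exact (hR _ _ (by simpa using h)).1 (by simpa using h)
  have hS : ∀ i j, (R (.inr i)).Meets (R (.inl j)) ↔ i = j := fun i j => by
    rw [← hR _ _ (by simp)]; simp
  have h1 := card_lt_three_of_collinear (fun i => R (.inl i)) (fun i => R (.inr i))
    (Finset.univ.filter fun i => (R (.inl i)).c = (R (.inl i)).d) (fun i _ => hq i)
    (fun i hi => (Finset.mem_filter.1 hi).2) (fun i _ j _ => hS i j)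
  have h2 := card_lt_three_of_collinear (fun i => (R (.inl i)).swap) (fun i => (R (.inr i)).swap)
    (Finset.univ.filter fun i => ¬ (R (.inl i)).c = (R (.inl i)).d) (x := y) (y := x)
    (fun i _ => ⟨(hq i).2.2.1, (hq i).2.2.2, (hq i).1, (hq i).2.1⟩)
    (fun i hi => (R (.inl i)).thin.resolve_right (Finset.mem_filter.1 hi).2)
    (fun i _ j _ => Seg.swap_meets.trans (hS i j))
  have h3 := Finset.card_filter_add_card_filter_not (s := (Finset.univ : Finset (Fin 5)))
    fun i => (R (.inl i)).c = (R (.inl i)).d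
  rw [Finset.card_univ, Fintype.card_fin] at h3
  omega

end

/-! ### Invariants of the family -/

/-- A finite connected block graph. -/
structure FinBlockGraph {W : Type u} (G : SimpleGraph W) : Prop where
  finite : Finite W
  connected : G.Connected
  locSep : LocSep G

/-- What the procedure uses about its two vertices `v i` and their endblocks `B i`, indexed by
`Bool`: outside the endblocks, both vertices see the same clique. -/
structure StepData {W : Type u} (G : SimpleGraph W) (v : Bool → W) (B : Bool → Set W) : Prop where
  mem : ∀ i, v i ∈ B i
  adj : ∀ i j, i ≠ j → G.Adj (v i) (v j)
  clique : ∀ i, G.IsClique (B i)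
  closed : ∀ i, ∀ u ∈ B i, u ≠ v i → ∀ z, G.Adj u z → z ∈ B i
  disj : ∀ i j, i ≠ j → ∀ u ∈ B i, u ∉ B j
  twin : ∀ w, (∀ i, w ∉ B i) → ∀ i j, G.Adj w (v i) → G.Adj w (v j)
  nbr_clique : ∀ w w', (∀ i, w ∉ B i) → (∀ i, w' ∉ B i) → ∀ i,
    G.Adj w (v i) → G.Adj w' (v i) → w ≠ w' → G.Adj w w'
  exists_nbr : ∃ w, (∀ i, w ∉ B i) ∧ ∀ i, G.Adj w (v i)

/-- The block `Q` through the clique `H` contains two cutpoints, so it is not an endblock, and the only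
blocks at `v i` are `Q` and `B i`. -/
theorem stepData_of_isTwoCutpoint {W : Type u} {G : SimpleGraph W} (hG : FinBlockGraph G)
    {H : Finset W} (hH : G.IsNClique 4 H) {v : Bool → W} (hv : v false ≠ v true)
    (hvH : ∀ i, v i ∈ H) (hv2 : ∀ i, IsTwoCutpoint G (v i)) {B : Bool → Set W}
    (hB : ∀ i, IsEndblock G (B i)) (hvB : ∀ i, v i ∈ B i) : StepData G v B := by
  have := hG.finite
  have hvne : ∀ i j, i ≠ j → v i ≠ v j := by
    intro i j hij
    cases i <;> cases j <;> simp_all [eq_comm]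
  obtain ⟨Q, hQ, hHQ⟩ := (Nonsep.of_isClique hH.isClique ⟨v false, hvH false⟩).exists_isBlock
  have hvQ : ∀ i, v i ∈ Q := fun i => hHQ (hvH i)
  have hQcl := hQ.isClique hG.locSep
  have hcut : ∀ i, ∀ u ∈ B i, IsCutpoint G u → u = v i := fun i u hu hc =>
    (hB i).2.unique ⟨hu, hc⟩ ⟨hvB i, (hv2 i).1⟩
  have hother : ∀ i j, i ≠ j → v j ∉ B i := fun i j hij h =>
    hvne i j hij (hcut i _ h (hv2 j).1).symm
  have hQB : ∀ i, Q ≠ B i := fun i h =>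
    hother i (!i) (by cases i <;> simp) (h ▸ hvQ (!i))
  -- the two blocks at `v i` are `Q` and `B i`
  have hblocks : ∀ i, ∀ C, IsBlock G C → v i ∈ C → C = Q ∨ C = B i := by
    intro i C hC hvC
    have hsub : ({Q, B i} : Set (Set W)) ⊆ {C | IsBlock G C ∧ v i ∈ C} := by
      rintro _ (rfl | rfl)
      · exact ⟨hQ, hvQ i⟩
      · exact ⟨(hB i).1, hvB i⟩
    have := Set.eq_of_subset_of_ncard_le hsub
      (by rw [(hv2 i).2.1, Set.ncard_pair (hQB i)]) (Set.toFinite _)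
    have hmem : C ∈ ({Q, B i} : Set (Set W)) := this ▸ ⟨hC, hvC⟩
    simpa using hmem
  have hnbr : ∀ i w, G.Adj w (v i) → w ∈ Q ∨ w ∈ B i := by
    intro i w hw
    obtain ⟨C, hC, hwC, hvC⟩ := exists_isBlock_of_adj hw
    rcases hblocks i C hC hvC with rfl | rfl
    · exact .inl hwC
    · exact .inr hwC
  have hBcl : ∀ i, G.IsClique (B i) := fun i => (hB i).1.isClique hG.locSep
  have hclosed : ∀ i, ∀ u ∈ B i, u ≠ v i → ∀ z, G.Adj u z → z ∈ B i := by
    intro i u hu huv z huz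
    by_contra hz
    have huv' : G.Adj u (v i) := hBcl i hu (hvB i) huv
    have hzv : z ≠ v i := fun h => hz (h ▸ hvB i)
    refine huv (hcut i u hu (isCutpoint_of_not_reachable hG.connected huv'.ne' huz.ne' fun h => ?_))
    rcases hG.locSep u _ _ huv' huz h with h | h
    · exact hzv h.symm
    · refine hz ((hB i).1.subset_of_nonsep (T := {u, v i, z}) (Nonsep.of_isClique ?_ ⟨u, by simp⟩)
        huv ⟨hu, by simp⟩ ⟨hvB i, by simp⟩ (by simp))
      intro p hp q hq hpq
      simp only [Set.mem_insert_iff, Set.mem_singleton_iff] at hp hq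
      rcases hp with rfl | rfl | rfl <;> rcases hq with rfl | rfl | rfl <;>
        first | exact absurd rfl hpq | assumption | exact SimpleGraph.Adj.symm (by assumption)
  refine ⟨hvB, fun i j hij => hH.isClique (hvH i) (hvH j) (hvne i j hij), hBcl, hclosed,
    ?_, ?_, ?_, ?_⟩
  · intro i j hij u hui huj
    have huv : u ≠ v j := fun h => hother i j hij (h ▸ hui)
    have huv' : u ≠ v i := fun h => hother j i hij.symm (h ▸ huj)
    exact hother i j hij (hclosed i u hui huv' _ (hBcl j huj (hvB j) huv))
  · intro w hw i j hwi
    exact hQcl ((hnbr i w hwi).resolve_right (hw i)) (hvQ j) fun h => hw j (h ▸ hvB j)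
  · intro w w' hw hw' i hwi hwi' hne
    exact hQcl ((hnbr i w hwi).resolve_right (hw i)) ((hnbr i w' hwi').resolve_right (hw' i)) hne
  · classical
    obtain ⟨w, hw, hwn⟩ := Finset.exists_mem_notMem_of_card_lt_card
      (s := {v false, v true}) (t := H) (Finset.card_le_two.trans_lt (by rw [hH.card_eq]; simp))
    simp only [Finset.mem_insert, Finset.mem_singleton, not_or] at hwn
    have hne : ∀ i, w ≠ v i := by rintro (_ | _); exacts [hwn.1, hwn.2]
    refine ⟨w, fun i hwB => ?_, fun i => hH.isClique hw (hvH i) (hne i)⟩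
    have hadj := hH.isClique hw (hvH (!i)) (hne (!i))
    exact hother i (!i) (by cases i <;> simp) (hclosed i w hwB (hne i) _ hadj)

/-! ### Adjacency after one application of the procedure -/

section StepAdj

variable {W : Type} {G : SimpleGraph W} {v₁ v₂ : W} {B₁ B₂ : Set W}

@[simp] theorem step_old_old {w w' : W} {h : w ∉ B₁ ∪ B₂} {h' : w' ∉ B₁ ∪ B₂} :
    (step G v₁ v₂ B₁ B₂).Adj (.old w h) (.old w' h') ↔ G.Adj w w' := by
  simp only [step, SimpleGraph.fromRel_adj, ne_eq, StepVertex.old.injEq, G.adj_comm w' w, or_self]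
  exact ⟨fun h => h.2, fun h => ⟨h.ne, h⟩⟩

@[simp] theorem step_old_x {w : W} {h : w ∉ B₁ ∪ B₂} :
    (step G v₁ v₂ B₁ B₂).Adj (.old w h) .x ↔ G.Adj w v₁ ∨ G.Adj w v₂ := by
  simp [step, SimpleGraph.fromRel_adj]

@[simp] theorem step_x_old {w : W} {h : w ∉ B₁ ∪ B₂} :
    (step G v₁ v₂ B₁ B₂).Adj .x (.old w h) ↔ G.Adj w v₁ ∨ G.Adj w v₂ := by
  simp [step, SimpleGraph.fromRel_adj]

@[simp] theorem step_old_spider {w : W} {h : w ∉ B₁ ∪ B₂} {i : Bool} {s : Fin 3 ⊕ Fin 3} :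
    ¬ (step G v₁ v₂ B₁ B₂).Adj (.old w h) (.spider i s) := by
  simp [step, SimpleGraph.fromRel_adj]

@[simp] theorem step_spider_old {w : W} {h : w ∉ B₁ ∪ B₂} {i : Bool} {s : Fin 3 ⊕ Fin 3} :
    ¬ (step G v₁ v₂ B₁ B₂).Adj (.spider i s) (.old w h) := by
  simp [step, SimpleGraph.fromRel_adj]

@[simp] theorem step_x_inl {i : Bool} {s : Fin 3} :
    (step G v₁ v₂ B₁ B₂).Adj .x (.spider i (.inl s)) := by
  simp [step, SimpleGraph.fromRel_adj]

@[simp] theorem step_inl_x {i : Bool} {s : Fin 3} :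
    (step G v₁ v₂ B₁ B₂).Adj (.spider i (.inl s)) .x := by
  simp [step, SimpleGraph.fromRel_adj]

@[simp] theorem step_x_inr {i : Bool} {s : Fin 3} :
    ¬ (step G v₁ v₂ B₁ B₂).Adj .x (.spider i (.inr s)) := by
  simp [step, SimpleGraph.fromRel_adj]

@[simp] theorem step_inr_x {i : Bool} {s : Fin 3} :
    ¬ (step G v₁ v₂ B₁ B₂).Adj (.spider i (.inr s)) .x := by
  simp [step, SimpleGraph.fromRel_adj]

@[simp] theorem step_spider_spider {i j : Bool} {s t : Fin 3 ⊕ Fin 3} :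
    (step G v₁ v₂ B₁ B₂).Adj (.spider i s) (.spider j t) ↔ i = j ∧ (thinSpider 3).Adj s t := by
  simp only [step, SimpleGraph.fromRel_adj, ne_eq, StepVertex.spider.injEq,
    (thinSpider 3).adj_comm t s, eq_comm (a := j) (b := i), or_self]
  exact ⟨fun h => h.2, fun h => ⟨fun h' => h.2.ne h'.2, h⟩⟩

end StepAdj

/-! ### The invariants hold throughout the family -/

theorem reachable_map {V : Type*} {W : Type*} {H : SimpleGraph V} {K : SimpleGraph W} (φ : V → W)
    (h : ∀ a b, H.Adj a b → K.Reachable (φ a) (φ b)) {a b : V} (hab : H.Reachable a b) :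
    K.Reachable (φ a) (φ b) := by
  rw [SimpleGraph.reachable_iff_reflTransGen] at hab
  induction hab with
  | refl => rfl
  | tail _ h2 ih => exact ih.trans (h _ _ h2)

theorem eq_of_reachable {V : Type*} {α : Type*} {H : SimpleGraph V} (φ : V → α)
    (h : ∀ a b, H.Adj a b → φ a = φ b) {a b : V} (hab : H.Reachable a b) : φ a = φ b := by
  rw [SimpleGraph.reachable_iff_reflTransGen] at hab
  induction hab with
  | refl => rfl
  | tail _ h2 ih => exact ih.trans (h _ _ h2)

theorem eq_of_reachable_of_pendant {V : Type*} {G : SimpleGraph V} {s v b : V}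
    (h : ∀ z, G.Adj s z → z = v) (hr : (G.deleteIncidenceSet v).Reachable s b) : s = b := by
  refine (iff_of_eq (eq_of_reachable (fun z => z = s) (fun p q hpq => ?_) hr)).1 rfl |>.symm
  rw [SimpleGraph.deleteIncidenceSet_adj] at hpq
  simp only [eq_iff_iff]
  constructor
  · rintro rfl; exact absurd (h _ hpq.1) hpq.2.2
  · rintro rfl; exact absurd (h _ hpq.1.symm) hpq.2.1

theorem finBlockGraph_thinSpider_five : FinBlockGraph (thinSpider 5) where
  finite := inferInstance
  connected := by
    have : ∀ z, (thinSpider 5).Reachable z (.inl 0) := by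
      have key : ∀ i, (thinSpider 5).Reachable (.inl i) (.inl 0) := fun i => by
        by_cases h : i = 0
        · rw [h]
        · exact SimpleGraph.Adj.reachable (by simpa using h)
      rintro (i | i)
      · exact key i
      · exact (SimpleGraph.Adj.reachable (by simp)).trans (key i)
    exact ⟨fun a b => (this a).trans (this b).symm⟩
  locSep := by
    rintro (i | i) (a | a) (b | b) ha hb h
    · simpa using em (a = b)
    · simp only [thinSpider_inl_inr] at ha hb
      exact .inl (eq_of_reachable_of_pendant
        (by rintro (z | z) <;> simp +contextual [hb]) h.symm).symm
    · simp only [thinSpider_inl_inr] at ha hb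
      exact .inl (eq_of_reachable_of_pendant (by rintro (z | z) <;> simp +contextual [ha]) h)
    · simp only [thinSpider_inl_inr] at ha hb
      exact .inl (by rw [← ha, ← hb])
    all_goals simp_all

instance {W : Type} [Finite W] (B₁ B₂ : Set W) : Finite (StepVertex B₁ B₂) := by
  refine Finite.of_injective (β := W ⊕ Option (Bool × (Fin 3 ⊕ Fin 3))) (fun z => match z with
    | .old w _ => .inl w
    | .x => .inr none
    | .spider i s => .inr (some (i, s))) ?_
  rintro (_ | _ | _) (_ | _ | _) h <;> simp_all

/-- The procedure leads from block graphs to block graphs. If an old vertex is removed, mapping `x` and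
the spiders to `v false` turns walks into walks of `G`; the other cases are local. -/
theorem StepData.finBlockGraph {W : Type} {G : SimpleGraph W} (hG : FinBlockGraph G) {v : Bool → W}
    {B : Bool → Set W} (hD : StepData G v B) :
    FinBlockGraph (step G (v false) (v true) (B false) (B true)) := by
  classical
  have := hG.finite
  have hout : ∀ w, w ∉ B false ∪ B true ↔ ∀ i, w ∉ B i := fun w => by
    simp only [Set.mem_union, not_or, Bool.forall_bool]
  set G' := step G (v false) (v true) (B false) (B true) with hG'
  refine ⟨inferInstance, ?_, ?_⟩
  · -- contracting the endblocks to `x` maps walks of `G` to walks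
    let φ : W → StepVertex (B false) (B true) := fun w =>
      if h : w ∉ B false ∪ B true then .old w h else .x
    have hφ : ∀ p q, G.Adj p q → G'.Reachable (φ p) (φ q) := by
      have hx : ∀ p q (hp : p ∉ B false ∪ B true), q ∈ B false ∪ B true → G.Adj p q →
          G'.Adj (.old p hp) .x := by
        intro p q hp hq hpq
        rw [hG', step_old_x]
        rcases hq with hq | hq
        · by_cases h : q = v false
          · exact .inl (h ▸ hpq)
          · exact absurd (.inl (hD.closed _ q hq h p hpq.symm)) hp
        · by_cases h : q = v true
          · exact .inr (h ▸ hpq)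
          · exact absurd (.inr (hD.closed _ q hq h p hpq.symm)) hp
      intro p q hpq
      by_cases hp : p ∉ B false ∪ B true <;> by_cases hq : q ∉ B false ∪ B true
      · simp only [φ, dif_pos hp, dif_pos hq]
        exact SimpleGraph.Adj.reachable (step_old_old.2 hpq)
      · simp only [φ, dif_pos hp, dif_neg hq]
        exact (hx p q hp (not_not.1 hq) hpq).reachable
      · simp only [φ, dif_neg hp, dif_pos hq]
        exact (hx q p hq (not_not.1 hp) hpq.symm).symm.reachable
      · simp only [φ, dif_neg hp, dif_neg hq]; rfl
    have key : ∀ z, G'.Reachable z .x := by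
      rintro (⟨w, hw⟩ | _ | ⟨i, c | c⟩)
      · have := reachable_map φ hφ (hG.connected.preconnected w (v false))
        have hv : v false ∈ B false ∪ B true := .inl (hD.mem false)
        simpa only [φ, dif_pos hw, dif_neg (not_not.2 hv)] using this
      · rfl
      · exact SimpleGraph.Adj.reachable step_inl_x
      · exact (SimpleGraph.Adj.reachable (v := .spider i (.inl c))
          (by simp [hG'])).trans (SimpleGraph.Adj.reachable step_inl_x)
    have : Nonempty (StepVertex (B false) (B true)) := ⟨.x⟩
    exact ⟨fun a b => (key a).trans (key b).symm⟩
  · rintro (⟨w, hw⟩ | _ | ⟨i, c | c⟩) a b ha hb hab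
    · let ψ : StepVertex (B false) (B true) → W := fun z => match z with
        | .old w _ => w
        | .x => v false
        | .spider _ _ => v false
      have hxv : ∀ p (hp : p ∉ B false ∪ B true), G'.Adj (.old p hp) .x → G.Adj p (v false) := by
        intro p hp h
        rw [hG', step_old_x] at h
        exact h.elim id (hD.twin p ((hout p).1 hp) true false)
      have hwv : w ≠ v false := fun h => hw (.inl (h ▸ hD.mem false))
      have hr : (G.deleteIncidenceSet w).Reachable (ψ a) (ψ b) := by
        refine reachable_map ψ (fun p q hpq => ?_) hab
        rw [SimpleGraph.deleteIncidenceSet_adj] at hpq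
        obtain ⟨hpq, hp, hq⟩ := hpq
        match p, q with
        | .old p hp', .old q hq' =>
          refine SimpleGraph.Adj.reachable (SimpleGraph.deleteIncidenceSet_adj.2
            ⟨step_old_old.1 hpq, fun h => hp ?_, fun h => hq ?_⟩)
          · subst h; rfl
          · subst h; rfl
        | .old p hp', .x =>
          refine SimpleGraph.Adj.reachable (SimpleGraph.deleteIncidenceSet_adj.2
            ⟨hxv p hp' hpq, fun h => hp ?_, hwv.symm⟩)
          subst h; rfl
        | .x, .old q hq' =>
          refine SimpleGraph.Adj.reachable (SimpleGraph.deleteIncidenceSet_adj.2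
            ⟨(hxv q hq' hpq.symm).symm, hwv.symm, fun h => hq ?_⟩)
          subst h; rfl
        | .x, .spider _ _ => rfl
        | .spider _ _, .x => rfl
        | .spider _ _, .spider _ _ => rfl
        | .x, .x => rfl
        | .old _ _, .spider _ _ => exact absurd hpq step_old_spider
        | .spider _ _, .old _ _ => exact absurd hpq step_spider_old
      match a, b with
      | .old a ha', .old b hb' =>
        simpa [hG'] using hG.locSep w a b (step_old_old.1 ha) (step_old_old.1 hb) hr
      | .x, .x => exact .inl rfl
      | .old a ha', .x =>
        rcases hG.locSep w a (v false) (step_old_old.1 ha) (hxv w hw hb) hr with h | h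
        · exact absurd (.inl (h ▸ hD.mem false)) ha'
        · exact .inr (step_old_x.2 (.inl h))
      | .x, .old b hb' =>
        rcases hG.locSep w (v false) b (hxv w hw ha) (step_old_old.1 hb) hr with h | h
        · exact absurd (.inl (h ▸ hD.mem false)) hb'
        · exact .inr (step_x_old.2 (.inl h.symm))
      | .spider _ _, _ => exact absurd ha step_old_spider
      | .old _ _, .spider _ _ => exact absurd hb step_old_spider
      | .x, .spider _ _ => exact absurd hb step_old_spider
    · -- removing `x` separates the old vertices from both spiders
      let label : StepVertex (B false) (B true) → Option (Option Bool) := fun z => match z with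
        | .old _ _ => some none
        | .x => none
        | .spider i _ => some (some i)
      have hl : label a = label b := by
        refine eq_of_reachable label (fun p q hpq => ?_) hab
        rw [SimpleGraph.deleteIncidenceSet_adj] at hpq
        obtain ⟨hpq, hp, hq⟩ := hpq
        match p, q with
        | .old p hp', .old q hq' => rfl
        | .x, _ => exact absurd rfl hp
        | .old _ _, .x => exact absurd rfl hq
        | .spider _ _, .x => exact absurd rfl hq
        | .spider i _, .spider j _ =>
          rw [hG', step_spider_spider] at hpq
          simp only [label, hpq.1]
        | .old _ _, .spider _ _ => exact absurd hpq step_old_spider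
        | .spider _ _, .old _ _ => exact absurd hpq step_spider_old
      match a, b with
      | .old a ha', .old b hb' =>
        by_cases hne : a = b
        · subst hne; exact .inl rfl
        rw [hG', step_x_old] at ha hb
        refine .inr (step_old_old.2 (hD.nbr_clique a b ((hout a).1 ha') ((hout b).1 hb') false
          ?_ ?_ hne))
        · exact ha.elim id (hD.twin a ((hout a).1 ha') true false)
        · exact hb.elim id (hD.twin b ((hout b).1 hb') true false)
      | .spider i (.inl s), .spider j (.inl t) =>
        have hij : i = j := by simpa [label] using hl
        subst hij
        by_cases hne : s = t
        · subst hne; exact .inl rfl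
        · exact .inr (step_spider_spider.2 ⟨rfl, by simpa using hne⟩)
      | .spider _ (.inr _), _ => exact absurd ha step_x_inr
      | .x, _ => exact absurd ha (G'.loopless.irrefl _)
      | .old _ _, .x => exact absurd hb (G'.loopless.irrefl _)
      | .spider _ (.inl _), .x => exact absurd hb (G'.loopless.irrefl _)
      | .old _ _, .spider _ _ => simp [label] at hl
      | .spider _ (.inl _), .old _ _ => simp [label] at hl
      | .spider _ (.inl _), .spider _ (.inr _) => exact absurd hb step_x_inr
    · have hpend : ∀ z, G'.Adj (.spider i (.inr c)) z → z = .spider i (.inl c) := by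
        rintro (_ | _ | ⟨j, s | s⟩) h <;> simp_all
      by_cases hac : a = .spider i (.inr c)
      · subst hac
        exact .inl (eq_of_reachable_of_pendant hpend hab)
      by_cases hbc : b = .spider i (.inr c)
      · subst hbc
        exact .inl (eq_of_reachable_of_pendant hpend hab.symm).symm
      have hcl : ∀ z, G'.Adj (.spider i (.inl c)) z → z ≠ .spider i (.inr c) →
          z = .x ∨ ∃ s, z = .spider i (.inl s) := by
        rintro (_ | _ | ⟨j, s | s⟩) h h' <;> simp_all
      rcases hcl a ha hac with rfl | ⟨s, rfl⟩ <;> rcases hcl b hb hbc with rfl | ⟨t, rfl⟩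
      · exact .inl rfl
      · exact .inr step_x_inl
      · exact .inr step_inl_x
      · by_cases hne : s = t
        · subst hne; exact .inl rfl
        · exact .inr (step_spider_spider.2 ⟨rfl, by simpa using hne⟩)
    · have hpend : ∀ z, G'.Adj (.spider i (.inr c)) z → z = .spider i (.inl c) := by
        rintro (_ | _ | ⟨j, s | s⟩) h <;> simp_all
      exact .inl ((hpend a ha).trans (hpend b hb).symm)

theorem stepData_of_step_hypotheses {W : Type} {G : SimpleGraph W} (hG : FinBlockGraph G)
    {H : Finset W} (hH : G.IsNClique 4 H) {v₁ v₂ : W} (hv : v₁ ≠ v₂) (hv₁H : v₁ ∈ H)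
    (hv₂H : v₂ ∈ H) (hv₁ : IsTwoCutpoint G v₁) (hv₂ : IsTwoCutpoint G v₂) {B₁ B₂ : Set W}
    (hB₁ : IsEndblock G B₁) (hB₂ : IsEndblock G B₂) (hvB₁ : v₁ ∈ B₁) (hvB₂ : v₂ ∈ B₂) :
    StepData G (fun i => bif i then v₂ else v₁) (fun i => bif i then B₂ else B₁) :=
  stepData_of_isTwoCutpoint hG hH hv (by rintro (_ | _) <;> assumption)
    (by rintro (_ | _) <;> assumption) (by rintro (_ | _) <;> assumption)
    (by rintro (_ | _) <;> assumption)

theorem FamilyF.finBlockGraph {W : Type} {G : SimpleGraph W} (hF : FamilyF G) :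
    FinBlockGraph G := by
  induction hF with
  | base => exact finBlockGraph_thinSpider_five
  | step _ H hH v₁ v₂ hv hv₁H hv₂H hv₁ hv₂ B₁ B₂ hB₁ hB₂ hvB₁ hvB₂ ih =>
    exact (stepData_of_step_hypotheses ih hH hv hv₁H hv₂H hv₁ hv₂ hB₁ hB₂ hvB₁
      hvB₂).finBlockGraph ih

/-! ### Members of the family have no representation -/

/-- If a clique of three pendanted segments `C i` and a horizontal segment share the point `(x, y)`,
then the horizontal segment cannot leave the clique on both sides: otherwise all `C i` would be
vertical. -/
theorem spider_not_between {α : Type*} [LinearOrder α] {r : Seg α}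
    {C S : Fin 3 → Seg α} {x x₁ x₂ y : α} (hC : ∀ i, (C i).Has x y)
    (hS : ∀ i j, (S i).Meets (C j) ↔ i = j) (hSr : ∀ i, ¬ (S i).Meets r)
    (h₁ : x₁ < x) (h₂ : x < x₂) (hr₁ : r.Has x₁ y) (hr₂ : r.Has x₂ y)
    (hC₁ : ∀ i, ¬ (C i).Has x₁ y) (hC₂ : ∀ i, ¬ (C i).Has x₂ y) : False := by
  have hvert : ∀ i, (C i).swap.c = (C i).swap.d := by
    intro i
    refine (C i).thin.resolve_right fun hor => hSr i ?_
    obtain ⟨p, q, hp, hp'⟩ := Seg.meets_iff.1 ((hS i i).2 rfl)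
    have hq := hC i
    refine Seg.meets_iff.2 ⟨p, q, hp, hr₁.1.trans ?_, le_trans ?_ hr₂.2.1, ?_, ?_⟩
    · by_contra! h
      exact hC₁ i ⟨hp'.1.trans h.le, h₁.le.trans hq.2.1, hq.2.2⟩
    · by_contra! h
      exact hC₂ i ⟨hq.1.trans h₂.le, h.le.trans hp'.2.1, hq.2.2⟩
    · exact hr₁.2.2.1.trans (hq.2.2.2.trans (hor ▸ hp'.2.2.1))
    · exact (hp'.2.2.2.trans (hor ▸ hq.2.2.1)).trans hr₁.2.2.2
  have := card_lt_three_of_collinear (fun i => (C i).swap) (fun i => (S i).swap) Finset.univ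
    (x := y) (y := x) (fun i _ => ⟨(hC i).2.2.1, (hC i).2.2.2, (hC i).1, (hC i).2.1⟩)
    (fun i _ => hvert i) (fun i _ j _ => Seg.swap_meets.trans (hS i j))
  simp at this

theorem hseg_has {α : Type*} [LinearOrder α] {x x' y p q : α} :
    (Seg.hseg x x' y).Has p q ↔ p ∈ Set.uIcc x x' ∧ q = y := by
  simp only [Seg.Has, Seg.hseg, Set.uIcc, Set.mem_Icc]
  exact ⟨fun h => ⟨⟨h.1, h.2.1⟩, le_antisymm h.2.2.2 h.2.2.1⟩,
    fun h => ⟨h.1.1, h.1.2, h.2.ge, h.2.le⟩⟩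

/-- The heart of the necessity of `𝓕`-freeness: the procedure can be undone on representations. The
two new spiders force the old clique at `x` to meet the path of `x` between their own cliques, so
this path may be cut at the old clique into a path for `v false` and a path for `v true`; the
endblocks are placed at the points of the spiders. -/
theorem StepData.exists_rep {W : Type} {G : SimpleGraph W} (hG : FinBlockGraph G) {v : Bool → W}
    {B : Bool → Set W} (hD : StepData G v B) {R : StepVertex (B false) (B true) → Seg ℤ}
    (hR : IsRep (step G (v false) (v true) (B false) (B true)) R) :
    ∃ R' : W → Seg ℤ, IsRep G R' := by
  classical
  have := hG.finite
  -- the path of `x` may be taken to be horizontal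
  wlog hhor : (R .x).c = (R .x).d generalizing R
  · exact this hR.swap ((R .x).thin.resolve_right hhor)
  have hout : ∀ w, w ∉ B false ∪ B true ↔ ∀ i, w ∉ B i := fun w => by
    simp only [Set.mem_union, not_or, Bool.forall_bool]
  let O : {w // w ∉ B false ∪ B true} → Seg ℤ := fun w => R (.old w.1 w.2)
  obtain ⟨y, hy⟩ : ∃ y, y = (R .x).c := ⟨_, rfl⟩
  have hline : ∀ p q, (R .x).Has p q → q = y := fun p q h =>
    hy ▸ le_antisymm (hhor ▸ h.2.2.2) h.2.2.1
  -- the points of the two spiders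
  have hX : ∀ i, ∃ p, (R .x).Has p y ∧ ∀ c, (R (.spider i (.inl c))).Has p y := by
    intro i
    obtain ⟨p, q, h⟩ := exists_common_point
      (fun o : Option (Fin 3) => R (o.elim .x fun c => .spider i (.inl c))) (by
        rintro (_ | c) (_ | c')
        · exact Seg.meets_self _
        · exact (hR _ _ (by simp)).1 step_x_inl
        · exact (hR _ _ (by simp)).1 step_inl_x
        · by_cases h : c = c'
          · subst h; exact Seg.meets_self _
          · exact (hR _ _ (by simpa using h)).1 (step_spider_spider.2 ⟨rfl, by simpa using h⟩))
    obtain rfl := hline p q (h none)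
    exact ⟨p, h none, fun c => h (some c)⟩
  choose X hXx hXc using hX
  -- the point of the old clique
  obtain ⟨q, hqx, hqw⟩ : ∃ q, (R .x).Has q y ∧
      ∀ w hw, (∃ i, G.Adj w (v i)) → (R (.old w hw)).Has q y := by
    obtain ⟨p, q, h⟩ := exists_common_point
      (fun o : Option {w : {w // w ∉ B false ∪ B true} // ∃ i, G.Adj w (v i)} =>
        R (o.elim .x fun w => .old w.1.1 w.1.2)) (by
        have hx : ∀ (w : W) (hw : w ∉ B false ∪ B true), (∃ i, G.Adj w (v i)) →
            (R (.old w hw)).Meets (R .x) := by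
          intro w hw hi
          refine (hR _ _ (by simp)).1 (step_old_x.2 ?_)
          obtain ⟨i, hi⟩ := hi
          cases i
          · exact .inl hi
          · exact .inr hi
        rintro (_ | ⟨⟨w, hw⟩, i, hi⟩) (_ | ⟨⟨w', hw'⟩, i', hi'⟩)
        · exact Seg.meets_self _
        · exact (hx w' hw' ⟨i', hi'⟩).symm
        · exact hx w hw ⟨i, hi⟩
        · by_cases h : w = w'
          · subst h; exact Seg.meets_self _
          · exact (hR _ _ (by simpa using h)).1 (step_old_old.2 (hD.nbr_clique w w'
              ((hout w).1 hw) ((hout w').1 hw') i hi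
              (hD.twin w' ((hout w').1 hw') i' i hi') h)))
    obtain rfl := hline p q (h none)
    exact ⟨p, h none, fun w hw hi => h (some ⟨⟨w, hw⟩, hi⟩)⟩
  obtain ⟨w₀, hw₀, hw₀v⟩ := hD.exists_nbr
  have hmeet : ∀ {a b : StepVertex (B false) (B true)} {p : ℤ}, a ≠ b → (R a).Has p y →
      (R b).Has p y → (step G (v false) (v true) (B false) (B true)).Adj a b :=
    fun hab ha hb => (hR _ _ hab).2 (Seg.meets_iff.2 ⟨_, _, ha, hb⟩)
  have hXold : ∀ i w hw, ¬ (R (.old w hw)).Has (X i) y := fun i w hw h =>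
    step_old_spider (hmeet (by simp) h (hXc i 0))
  have hXspider : ∀ i j, i ≠ j → ∀ c, ¬ (R (.spider i (.inl c))).Has (X j) y := fun i j hij c h =>
    hij (step_spider_spider.1 (hmeet (by simp [hij]) h (hXc j 0))).1
  have hqspider : ∀ i c, ¬ (R (.spider i (.inl c))).Has q y := fun i c h =>
    step_spider_old (hmeet (by simp) h (hqw w₀ ((hout w₀).2 hw₀) ⟨false, hw₀v false⟩))
  have hXq : ∀ i, X i ≠ q := fun i h => hqspider i 0 (h ▸ hXc i 0)
  have hXX : ∀ i j, i ≠ j → X i ≠ X j := fun i j hij h => hXspider i j hij 0 (h ▸ hXc i 0)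
  -- the point of a spider is not between the two other points
  have hside : ∀ i j, i ≠ j → ¬ (X j < X i ∧ X i < q) ∧ ¬ (q < X i ∧ X i < X j) := by
    intro i j hij
    have h1 : ∀ c c', (R (.spider i (.inr c))).Meets (R (.spider i (.inl c'))) ↔ c = c' := by
      intro c c'
      rw [← hR _ _ (by simp), step_spider_spider]
      simp
    have h2 : ∀ c, ¬ (R (.spider i (.inr c))).Meets (R .x) := fun c h =>
      step_inr_x ((hR _ _ (by simp)).2 h)
    exact ⟨fun h => spider_not_between (hXc i) h1 h2 h.1 h.2 (hXx j) hqx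
        (hXspider i j hij) (hqspider i),
      fun h => spider_not_between (hXc i) h1 h2 h.1 h.2 hqx (hXx j)
        (hqspider i) (hXspider i j hij)⟩
  have hbetween : ∀ i j, i ≠ j → ∀ p, p ∈ Set.uIcc (X i) q → p ∈ Set.uIcc (X j) q → p = q := by
    intro i j hij p hp hp'
    have h1 := hside i j hij
    have h2 := hside j i hij.symm
    have h3 := hXq i
    have h4 := hXq j
    have h5 := hXX i j hij
    rw [Set.mem_uIcc] at hp hp'
    omega
  have hsub : ∀ i p, p ∈ Set.uIcc (X i) q → (R .x).Has p y := by
    intro i p hp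
    have h1 := hXx i
    simp only [Seg.Has, Set.mem_uIcc] at *
    omega
  -- the new representation
  let R' : W → Seg ℤ := fun w =>
    if h : w ∉ B false ∪ B true then R (.old w h)
    else if w = v false then Seg.hseg (X false) q y
    else if w = v true then Seg.hseg (X true) q y
    else if w ∈ B false then Seg.point (X false) y else Seg.point (X true) y
  have hvne : ∀ i j, i ≠ j → v i ≠ v j := fun i j hij => (hD.adj i j hij).ne
  have hR'old : ∀ w (hw : w ∉ B false ∪ B true), R' w = R (.old w hw) := fun w hw => dif_pos hw
  have hR'v : ∀ i, R' (v i) = Seg.hseg (X i) q y := by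
    have h0 : ¬ v false ∉ B false ∪ B true := not_not.2 (.inl (hD.mem _))
    have h1 : ¬ v true ∉ B false ∪ B true := not_not.2 (.inr (hD.mem _))
    rintro (_ | _)
    · simp only [R', dif_neg h0, if_true]
    · simp only [R', dif_neg h1, if_neg (hvne true false (by simp)), if_true]
  have hBv : ∀ i j, ∀ u ∈ B i, u ≠ v i → u ≠ v j := by
    rintro i j u hu huv rfl
    exact hD.disj i j (fun h => huv (by rw [h])) _ hu (hD.mem j)
  have hR'B : ∀ i, ∀ u ∈ B i, u ≠ v i → R' u = Seg.point (X i) y := by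
    intro i u hu huv
    have h0 : ¬ u ∉ B false ∪ B true := not_not.2 (by cases i; exacts [.inl hu, .inr hu])
    simp only [R', dif_neg h0, if_neg (hBv i _ u hu huv)]
    cases i
    · simp only [hu, if_true]
    · simp only [if_neg (hD.disj true false (by simp) u hu)]
  have hcases : ∀ w, (∃ i, w = v i) ∨ (∃ i, w ∈ B i ∧ w ≠ v i) ∨ w ∉ B false ∪ B true := by
    intro w
    by_cases hw : w ∉ B false ∪ B true
    · exact .inr (.inr hw)
    · rw [hout] at hw
      push Not at hw
      obtain ⟨i, hi⟩ := hw
      by_cases h : w = v i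
      · exact .inl ⟨i, h⟩
      · exact .inr (.inl ⟨i, hi, h⟩)
  have hVB : ∀ i j u, u ∈ B j → u ≠ v j → (G.Adj u (v i) ↔ (R' u).Meets (R' (v i))) := by
    intro i j u hu huv
    rw [hR'v, hR'B j u hu huv, Seg.point_meets, hseg_has]
    by_cases hij : i = j
    · subst hij
      exact iff_of_true (hD.clique i hu (hD.mem i) huv) ⟨Set.left_mem_uIcc, rfl⟩
    · refine iff_of_false (fun h => ?_) fun h => ?_
      · exact hD.disj i j hij _ (hD.mem i) (hD.closed j u hu huv _ h)
      · exact hXq j (hbetween i j hij _ h.1 Set.left_mem_uIcc)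
  have hVO : ∀ i w, w ∉ B false ∪ B true → (G.Adj w (v i) ↔ (R' w).Meets (R' (v i))) := by
    intro i w hw
    rw [hR'v, hR'old w hw]
    constructor
    · intro h
      exact Seg.meets_iff.2 ⟨q, y, hqw w hw ⟨i, h⟩, hseg_has.2 ⟨Set.right_mem_uIcc, rfl⟩⟩
    · intro h
      obtain ⟨p, z, h1, h2⟩ := Seg.meets_iff.1 h
      obtain ⟨hp, rfl⟩ := hseg_has.1 h2
      have := step_old_x.1 (hmeet (by simp) h1 (hsub i p hp))
      exact this.elim (hD.twin w ((hout w).1 hw) _ _) (hD.twin w ((hout w).1 hw) _ _)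
  have hBO : ∀ i u w, u ∈ B i → u ≠ v i → w ∉ B false ∪ B true →
      (G.Adj u w ↔ (R' u).Meets (R' w)) := by
    intro i u w hu huv hw
    rw [hR'B i u hu huv, hR'old w hw, Seg.point_meets]
    exact iff_of_false (fun h => (hout w).1 hw i (hD.closed i u hu huv _ h)) (hXold i w hw)
  have hsymm : ∀ {a b}, (G.Adj a b ↔ (R' a).Meets (R' b)) → (G.Adj b a ↔ (R' b).Meets (R' a)) :=
    fun {a b} h => by rw [G.adj_comm, Seg.meets_comm]; exact h
  refine ⟨R', fun a b hab => ?_⟩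
  rcases hcases a with ⟨i, rfl⟩ | ⟨i, ha, hav⟩ | ha <;>
    rcases hcases b with ⟨j, rfl⟩ | ⟨j, hb, hbv⟩ | hb
  · have hij : i ≠ j := fun h => hab (by rw [h])
    refine iff_of_true (hD.adj i j hij) ?_
    rw [hR'v, hR'v]
    exact Seg.meets_iff.2 ⟨q, y, hseg_has.2 ⟨Set.right_mem_uIcc, rfl⟩,
      hseg_has.2 ⟨Set.right_mem_uIcc, rfl⟩⟩
  · exact hsymm (hVB i j b hb hbv)
  · exact hsymm (hVO i b hb)
  · exact hVB j i a ha hav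
  · rw [hR'B i a ha hav, hR'B j b hb hbv, Seg.point_meets]
    by_cases hij : i = j
    · subst hij
      exact iff_of_true (hD.clique i ha hb hab) ⟨le_rfl, le_rfl, le_rfl, le_rfl⟩
    · refine iff_of_false (fun h => hD.disj j i (Ne.symm hij) b hb (hD.closed i a ha hav _ h))
        fun h => hXX i j hij (le_antisymm h.2.1 h.1)
  · exact hBO i a b ha hav hb
  · exact hVO j a ha
  · exact hsymm (hBO j b a hb hbv ha)
  · rw [hR'old a ha, hR'old b hb, ← hR _ _ (by simpa using hab), step_old_old]

theorem FamilyF.not_rep {W : Type} {G : SimpleGraph W} (hF : FamilyF G) (R : W → Seg ℤ) :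
    ¬ IsRep G R := by
  induction hF with
  | base => exact thinSpider_five_not_rep R
  | step hG H hH v₁ v₂ hv hv₁H hv₂H hv₁ hv₂ B₁ B₂ hB₁ hB₂ hvB₁ hvB₂ ih =>
    intro hR
    obtain ⟨R', hR'⟩ := (stepData_of_step_hypotheses hG.finBlockGraph hH hv hv₁H hv₂H hv₁ hv₂
      hB₁ hB₂ hvB₁ hvB₂).exists_rep hG.finBlockGraph hR
    exact ih R' hR'

theorem IsB0VPG.isFFree {V : Type u} {G : SimpleGraph V} (h : IsB0VPG G) : IsFFree G := by
  rintro W F hF ⟨f⟩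
  obtain ⟨R, hR⟩ := isB0VPG_iff.1 h
  exact hF.not_rep _ (hR.comp_embedding f)

section

variable {V : Type u} {G : SimpleGraph V}

/-! ### Chordal diamond-free graphs are block graphs -/

theorem cycleGraph_adj_iff_val {n : ℕ} (i j : Fin (n + 2)) :
    (SimpleGraph.cycleGraph (n + 2)).Adj i j ↔
      (i : ℕ) + 1 = j ∨ (j : ℕ) + 1 = i ∨ ((i : ℕ) = n + 1 ∧ (j : ℕ) = 0) ∨
        ((i : ℕ) = 0 ∧ (j : ℕ) = n + 1) := by
  rw [SimpleGraph.cycleGraph_adj']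
  have key : ∀ i j : Fin (n + 2), (i - j).val = 1 ↔
      (j : ℕ) + 1 = i ∨ ((i : ℕ) = 0 ∧ (j : ℕ) = n + 1) := by
    intro i j
    have hi := i.isLt
    have hj := j.isLt
    rw [Fin.val_sub]
    rcases Nat.lt_or_ge i j with h | h
    · rw [Nat.mod_eq_of_lt (by omega)]
      omega
    · rw [show n + 2 - (j : ℕ) + i = (i - j : ℕ) + (n + 2) by omega, Nat.add_mod_right,
        Nat.mod_eq_of_lt (by omega)]
      omega
  rw [key, key]
  tauto

theorem diamond_adj_iff (i j : Fin 4) :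
    diamond.Adj i j ↔ i ≠ j ∧ ¬ (i = 0 ∧ j = 1) ∧ ¬ (i = 1 ∧ j = 0) := by
  simp only [diamond, SimpleGraph.deleteEdges_adj, SimpleGraph.top_adj, Set.mem_singleton_iff,
    Sym2.eq_iff]
  tauto

theorem isIndContained_diamond {a b c d : V} (hab : a ≠ b) (hnab : ¬ G.Adj a b) (hac : G.Adj a c)
    (had : G.Adj a d) (hbc : G.Adj b c) (hbd : G.Adj b d) (hcd : G.Adj c d) :
    diamond.IsIndContained G := by
  have hf : ∀ i j : Fin 4, G.Adj (![a, b, c, d] i) (![a, b, c, d] j) ↔ diamond.Adj i j := by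
    have hnab' : ¬ G.Adj b a := fun h => hnab h.symm
    intro i j
    rw [diamond_adj_iff]
    fin_cases i <;> fin_cases j <;>
      simp [hnab, hac, had, hbc, hbd, hcd, hac.symm, had.symm, hbc.symm, hbd.symm, hcd.symm,
        hnab']
  refine ⟨⟨⟨![a, b, c, d], fun i j hij => ?_⟩, fun {i j} => hf i j⟩⟩
  fin_cases i <;> fin_cases j <;>
    first
      | rfl
      | (simp only [Fin.mk_zero, Fin.mk_one, Fin.reduceFinMk, Matrix.cons_val] at hij
         first
          | exact absurd hij hab | exact absurd hij hab.symm
          | exact absurd hij hac.ne | exact absurd hij hac.ne' | exact absurd hij had.ne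
          | exact absurd hij had.ne' | exact absurd hij hbc.ne | exact absurd hij hbc.ne'
          | exact absurd hij hbd.ne | exact absurd hij hbd.ne' | exact absurd hij hcd.ne
          | exact absurd hij hcd.ne')

/-- A shortest path avoiding `v` between two nonadjacent neighbours of `v` closes up through `v` to
an induced cycle or, if it has length two, to a diamond. -/
theorem locSep_of_isChordal (hc : IsChordal G) (hd : IsDiamondFree G) : LocSep G := by
  intro v
  suffices h : ∀ n a b (p : (G.deleteIncidenceSet v).Walk a b), p.length = n → G.Adj v a →
      G.Adj v b → a = b ∨ G.Adj a b from fun a b ha hb ⟨p⟩ => h _ a b p rfl ha hb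
  intro n
  induction n using Nat.strong_induction_on with
  | _ n ih =>
  intro a b p hp ha hb
  by_contra! hab
  -- by induction, `p` is a shortest walk from `a` to `b`
  have hmin : ∀ q : (G.deleteIncidenceSet v).Walk a b, n ≤ q.length := by
    intro q
    by_contra! h
    exact (ih _ h a b q rfl ha hb).elim hab.1 hab.2
  let f : ℕ → V := fun i => p.getVert i
  have hf0 : f 0 = a := p.getVert_zero
  have hfn : f n = b := by rw [← hp]; exact p.getVert_length
  have hpre : ∀ i, i ≤ n → ∀ q : (G.deleteIncidenceSet v).Walk a (f i), i ≤ q.length := by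
    intro i hi q
    have := hmin (q.append (p.drop i))
    rw [SimpleGraph.Walk.length_append, SimpleGraph.Walk.drop_length, hp] at this
    omega
  have htake : ∀ i, i ≤ n → (p.take i).length = i := by
    intro i hi
    rw [SimpleGraph.Walk.take_length]
    omega
  have hsucc : ∀ i, i < n → (G.deleteIncidenceSet v).Adj (f i) (f (i + 1)) := fun i hi =>
    p.adj_getVert_succ (by omega)
  have hclose : ∀ i j, i ≤ n → j ≤ n → (G.deleteIncidenceSet v).Adj (f i) (f j) → j ≤ i + 1 := by
    intro i j hi hj hij
    have := hpre j hj ((p.take i).concat hij)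
    rwa [SimpleGraph.Walk.length_concat, htake i hi] at this
  have hne : ∀ i j, i < j → j ≤ n → f i ≠ f j := by
    intro i j hij hj h
    have := hpre j hj ((p.take i).copy rfl h)
    rw [SimpleGraph.Walk.length_copy, htake i (by omega)] at this
    omega
  have hn2 : 2 ≤ n := by
    by_contra! h
    interval_cases n
    · exact hab.1 (hf0.symm.trans hfn)
    · have := hsucc 0 (by omega)
      rw [hf0, hfn, SimpleGraph.deleteIncidenceSet_adj] at this
      exact hab.2 this.1
  have hfv : ∀ i, i ≤ n → f i ≠ v := by
    intro i hi
    rcases Nat.lt_or_ge i n with h | h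
    · exact ((SimpleGraph.deleteIncidenceSet_adj.1 (hsucc i h)).2.1)
    · rw [show i = n by omega, hfn]; exact hb.ne'
  have hadj : ∀ i j, i ≤ n → j ≤ n → (G.Adj (f i) (f j) ↔ i + 1 = j ∨ j + 1 = i) := by
    intro i j hi hj
    constructor
    · intro h
      have h' : (G.deleteIncidenceSet v).Adj (f i) (f j) :=
        SimpleGraph.deleteIncidenceSet_adj.2 ⟨h, hfv i hi, hfv j hj⟩
      have h1 := hclose i j hi hj h'
      have h2 := hclose j i hj hi h'.symm
      have h3 : i ≠ j := fun e => h.ne (by rw [e])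
      omega
    · rintro (rfl | rfl)
      · exact (SimpleGraph.deleteIncidenceSet_adj.1 (hsucc i (by omega))).1
      · exact (SimpleGraph.deleteIncidenceSet_adj.1 (hsucc j (by omega))).1.symm
  -- no inner vertex of the path is adjacent to `v`
  have hinner : ∀ i, 0 < i → i < n → ¬ G.Adj v (f i) := by
    intro i hi0 hin hvi
    have h1 : G.Adj (f 0) (f i) := by
      rcases ih i hin a (f i) (p.take i) (htake i hin.le) ha hvi with h | h
      · exact absurd (hf0.trans h) (hne 0 i hi0 hin.le)
      · rwa [hf0]
    have h2 : G.Adj (f i) (f n) := by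
      rcases ih (n - i) (by omega) (f i) b (p.drop i)
        (by rw [SimpleGraph.Walk.drop_length, hp]) hvi hb with h | h
      · exact absurd (h.trans hfn.symm) (hne i n hin le_rfl)
      · rwa [hfn]
    rw [hf0] at h1
    rw [hfn] at h2
    exact hd (isIndContained_diamond hab.1 hab.2 ha.symm h1 hb.symm h2.symm hvi)
  refine hc (n + 2) (by omega) ⟨⟨⟨fun i => if (i : ℕ) = n + 1 then v else f i, ?_⟩, ?_⟩⟩
  · intro i j hij
    have hi := i.isLt
    have hj := j.isLt
    simp only at hij
    apply Fin.ext
    split_ifs at hij with h1 h2 h2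
    · omega
    · exact absurd hij.symm (hfv j (by omega))
    · exact absurd hij (hfv i (by omega))
    · rcases lt_trichotomy (i : ℕ) j with h | h | h
      · exact absurd hij (hne i j h (by omega))
      · exact h
      · exact absurd hij.symm (hne j i h (by omega))
  · have hvf : ∀ i, i ≤ n → (G.Adj v (f i) ↔ i = 0 ∨ i = n) := by
      intro i hi
      constructor
      · intro h
        by_contra! h'
        exact hinner i (by omega) (by omega) h
      · rintro (rfl | rfl)
        · rwa [hf0]
        · rwa [hfn]
    intro i j
    have hi := i.isLt
    have hj := j.isLt
    rw [cycleGraph_adj_iff_val]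
    change G.Adj (if (i : ℕ) = n + 1 then v else f i) (if (j : ℕ) = n + 1 then v else f j) ↔ _
    split_ifs with h1 h2 h2
    · simp only [SimpleGraph.irrefl, false_iff]; omega
    · rw [hvf j (by omega)]; omega
    · rw [G.adj_comm, hvf i (by omega)]; omega
    · rw [hadj i j (by omega) (by omega)]; omega

end

section

variable {V : Type u} {G : SimpleGraph V}

/-! ### Passing from rational to integral coordinates -/

/-- Only finitely many coordinates occur, and an order embedding of these into `ℤ` preserves which
segments meet. -/
theorem isB0VPG_of_isRep_rat [Finite V] {R : V → Seg ℚ} (hR : IsRep G R) : IsB0VPG G := by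
  classical
  have := Fintype.ofFinite V
  let C : Finset ℚ := Finset.univ.biUnion fun v => {(R v).a, (R v).b, (R v).c, (R v).d}
  let φ : ℚ → ℤ := fun q => ((C.filter fun c => c < q).card : ℤ)
  have hmono : Monotone φ := fun p q hpq => by
    simp only [φ, Nat.cast_le]
    exact Finset.card_le_card (Finset.monotone_filter_right _ fun c _ hc => lt_of_lt_of_le hc hpq)
  have hφ : ∀ p ∈ C, ∀ q, φ q ≤ φ p ↔ q ≤ p := by
    refine fun p hp q => ⟨fun h => ?_, fun h => hmono h⟩
    by_contra! hlt
    refine absurd h (not_le.2 ?_)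
    simp only [φ, Nat.cast_lt]
    refine Finset.card_lt_card (Finset.ssubset_iff_of_subset ?_ |>.2 ⟨p, ?_, ?_⟩)
    · exact Finset.monotone_filter_right _ fun c _ hc => lt_trans hc hlt
    · exact Finset.mem_filter.2 ⟨hp, hlt⟩
    · simp
  have hmem : ∀ v, (R v).b ∈ C ∧ (R v).d ∈ C := fun v =>
    ⟨Finset.mem_biUnion.2 ⟨v, by simp⟩, Finset.mem_biUnion.2 ⟨v, by simp⟩⟩
  refine isB0VPG_iff.2 ⟨fun v => ⟨φ (R v).a, φ (R v).b, φ (R v).c, φ (R v).d, hmono (R v).hab,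
    hmono (R v).hcd, (R v).thin.imp (congrArg φ) (congrArg φ)⟩, fun v w hvw => ?_⟩
  rw [hR v w hvw]
  simp only [Seg.Meets, hφ _ (hmem v).1, hφ _ (hmem v).2, hφ _ (hmem w).1, hφ _ (hmem w).2]

/-! ### Representations of branches -/

/-- `R` represents the subgraph induced on `S`. -/
def RepOn (G : SimpleGraph V) (S : Set V) (R : V → Seg ℚ) : Prop :=
  ∀ v ∈ S, ∀ w ∈ S, v ≠ w → (G.Adj v w ↔ (R v).Meets (R w))

/-- The segment lies in the open rectangle `(x₁, x₂) × (y₁, y₂)`. -/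
def Seg.InBox (s : Seg ℚ) (x₁ x₂ y₁ y₂ : ℚ) : Prop := x₁ < s.a ∧ s.b < x₂ ∧ y₁ < s.c ∧ s.d < y₂

/-- The set `A`, attached to the vertex `a`, is representable on one side of a point of `a`: with
`a` drawn as `[0, e] × {0}`, the set `A` is drawn in the open rectangle to the right of the origin.
Thus `a` needs only one of its two directions at the origin. -/
def Arm (G : SimpleGraph V) (a : V) (A : Set V) : Prop :=
  ∃ (R : V → Seg ℚ) (e : ℚ), 0 < e ∧ e < 1 ∧ RepOn G A R ∧ (∀ w ∈ A, (R w).InBox 0 1 (-1) 1) ∧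
    ∀ w ∈ A, (G.Adj a w ↔ (R w).a ≤ e ∧ (R w).c ≤ 0 ∧ 0 ≤ (R w).d)

/-- The set `S` is representable around the origin when `v` is drawn as a line passing through;
such branches can be attached anywhere along the path of `v`. -/
def RepMid (G : SimpleGraph V) (v : V) (S : Set V) : Prop :=
  ∃ R : V → Seg ℚ, RepOn G S R ∧ (∀ w ∈ S, (R w).InBox (-1) 1 (-1) 1) ∧
    ∀ w ∈ S, (G.Adj v w ↔ (R w).c ≤ 0 ∧ 0 ≤ (R w).d)

/-- The set `S` is representable around the origin when `v` is drawn as the ray ending at the origin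
from the left; such branches can be attached at the two ends of the path of `v`. -/
def RepEnd (G : SimpleGraph V) (v : V) (S : Set V) : Prop :=
  ∃ R : V → Seg ℚ, RepOn G S R ∧ (∀ w ∈ S, (R w).InBox (-1) 1 (-1) 1) ∧
    ∀ w ∈ S, (G.Adj v w ↔ (R w).a ≤ 0 ∧ (R w).c ≤ 0 ∧ 0 ≤ (R w).d)

/-- Compression of the first coordinate by the factor two, with fixed point `t`. -/
def Seg.half (s : Seg ℚ) (t : ℚ) : Seg ℚ :=
  ⟨(s.a + t) / 2, (s.b + t) / 2, s.c, s.d, by have := s.hab; linarith, s.hcd,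
    s.thin.imp (fun h => by rw [h]) id⟩

theorem Seg.half_meets {s s' : Seg ℚ} {t : ℚ} : (s.half t).Meets (s'.half t) ↔ s.Meets s' := by
  simp only [Seg.Meets, Seg.half]
  constructor <;> rintro ⟨h1, h2, h3, h4⟩ <;> refine ⟨?_, ?_, h3, h4⟩ <;> linarith

theorem Arm.empty (G : SimpleGraph V) (a : V) : Arm G a ∅ :=
  ⟨fun _ => Seg.point 0 0, 1 / 2, by norm_num, by norm_num, by simp [RepOn], by simp, by simp⟩

theorem RepEnd.arm {a : V} {S : Set V} (h : RepEnd G a S) : Arm G a S := by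
  obtain ⟨R, h1, h2, h3⟩ := h
  refine ⟨fun w => (R w).half 1, 1 / 2, by norm_num, by norm_num,
    fun v hv w hw hvw => (h1 v hv w hw hvw).trans Seg.half_meets.symm, fun w hw => ?_,
    fun w hw => ?_⟩
  · obtain ⟨b1, b2, b3, b4⟩ := h2 w hw
    refine ⟨?_, ?_, b3, b4⟩ <;> simp only [Seg.half] <;> linarith
  · rw [h3 w hw]
    simp only [Seg.half]
    constructor <;> rintro ⟨h1, h2⟩ <;> refine ⟨?_, h2⟩ <;> linarith

/-- A branch through which `a` passes is inserted between the origin and the rest of an arm. -/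
theorem Arm.union {a : V} {A S : Set V} (hA : Arm G a A) (hS : RepMid G a S)
    (hAS : ∀ v ∈ A, ∀ w ∈ S, v ≠ w ∧ ¬ G.Adj v w) : Arm G a (A ∪ S) := by
  classical
  obtain ⟨R, e, he0, he1, h1, h2, h3⟩ := hA
  obtain ⟨R', h1', h2', h3'⟩ := hS
  let Q : V → Seg ℚ := fun w => if w ∈ A then (R w).half 1 else ((R' w).half 1).half 0
  have hQA : ∀ w ∈ A, Q w = (R w).half 1 := fun w hw => if_pos hw
  have hQS : ∀ w ∈ S, Q w = ((R' w).half 1).half 0 := fun w hw =>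
    if_neg fun h => (hAS w h w hw).1 rfl
  have hcross : ∀ v ∈ A, ∀ w ∈ S, ¬ (Q v).Meets (Q w) := by
    intro v hv w hw h
    rw [hQA v hv, hQS w hw] at h
    have h5 := (h2 v hv).1
    have h6 := (h2' w hw).2.1
    have h7 := h.1
    simp only [Seg.half] at h7
    linarith
  refine ⟨Q, (e + 1) / 2, by linarith, by linarith, ?_, ?_, ?_⟩
  · rintro v (hv | hv) w (hw | hw) hvw
    · rw [hQA v hv, hQA w hw, Seg.half_meets]; exact h1 v hv w hw hvw
    · exact iff_of_false (hAS v hv w hw).2 (hcross v hv w hw)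
    · exact iff_of_false (fun h => (hAS w hw v hv).2 h.symm) fun h => hcross w hw v hv h.symm
    · rw [hQS v hv, hQS w hw, Seg.half_meets, Seg.half_meets]; exact h1' v hv w hw hvw
  · rintro w (hw | hw)
    · obtain ⟨b1, b2, b3, b4⟩ := h2 w hw
      rw [hQA w hw]
      refine ⟨?_, ?_, b3, b4⟩ <;> simp only [Seg.half] <;> linarith
    · obtain ⟨b1, b2, b3, b4⟩ := h2' w hw
      rw [hQS w hw]
      refine ⟨?_, ?_, b3, b4⟩ <;> simp only [Seg.half] <;> linarith
  · rintro w (hw | hw)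
    · rw [hQA w hw, h3 w hw]
      simp only [Seg.half]
      constructor <;> rintro ⟨h1, h2⟩ <;> refine ⟨?_, h2⟩ <;> linarith
    · rw [hQS w hw, h3' w hw]
      have h4 := (R' w).hab
      have h5 := (h2' w hw).2.1
      simp only [Seg.half]
      exact ⟨fun h => ⟨by linarith, h⟩, fun h => h.2⟩

/-! ### Assembling a clique from arms -/

/-- The three directions available at the point of a clique when one direction is left to the vertex
that carries the clique. -/
inductive Dir | up | down | right

/-- An arm is turned in the given direction and moved away from the origin. -/
def Dir.turn (d : Dir) (s : Seg ℚ) : Seg ℚ :=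
  match d with
  | .right => ⟨(1 + s.a) / 2, (1 + s.b) / 2, s.c / 2, s.d / 2, by have := s.hab; linarith,
      by have := s.hcd; linarith, s.thin.imp (fun h => by rw [h]) fun h => by rw [h]⟩
  | .up => ⟨s.c / 2, s.d / 2, (1 + s.a) / 2, (1 + s.b) / 2, by have := s.hcd; linarith,
      by have := s.hab; linarith, s.thin.symm.imp (fun h => by rw [h]) fun h => by rw [h]⟩
  | .down => ⟨s.c / 2, s.d / 2, -((1 + s.b) / 2), -((1 + s.a) / 2), by have := s.hcd; linarith,
      by have := s.hab; linarith, s.thin.symm.imp (fun h => by rw [h]) fun h => by rw [h]⟩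

theorem Dir.turn_meets {d : Dir} {s t : Seg ℚ} : (d.turn s).Meets (d.turn t) ↔ s.Meets t := by
  cases d <;> simp only [Dir.turn, Seg.Meets] <;> constructor <;> rintro ⟨h1, h2, h3, h4⟩ <;>
    refine ⟨?_, ?_, ?_, ?_⟩ <;> linarith

theorem Dir.turn_not_meets {d d' : Dir} (hd : d ≠ d') {s t : Seg ℚ} (hs : s.InBox 0 1 (-1) 1)
    (ht : t.InBox 0 1 (-1) 1) : ¬ (d.turn s).Meets (d'.turn t) := by
  obtain ⟨s1, s2, s3, s4⟩ := hs
  obtain ⟨t1, t2, t3, t4⟩ := ht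
  have := s.hab
  have := t.hab
  cases d <;> cases d' <;> first | exact absurd rfl hd | skip
  all_goals
    simp only [Dir.turn, Seg.Meets]
    rintro ⟨h1, h2, h3, h4⟩
    linarith

theorem Dir.turn_inBox {d : Dir} {s : Seg ℚ} (hs : s.InBox 0 1 (-1) 1) :
    (d.turn s).InBox (-1) 1 (-1) 1 := by
  obtain ⟨s1, s2, s3, s4⟩ := hs
  have := s.hab
  have := s.hcd
  cases d <;> simp only [Dir.turn, Seg.InBox] <;> refine ⟨?_, ?_, ?_, ?_⟩ <;> linarith

section Cross

variable (o : Dir → Option V) (e : Dir → ℚ)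

open Classical in
/-- How far the clique vertex `k` extends in direction `d`. -/
noncomputable def reach (k : V) (d : Dir) : ℚ := if o d = some k then (1 + e d) / 2 else 0

theorem reach_nonneg (he : ∀ d, 0 < e d ∧ e d < 1) (k : V) (d : Dir) :
    0 ≤ reach o e k d ∧ reach o e k d < 1 := by
  have := he d
  unfold reach
  split_ifs
  · exact ⟨by linarith, by linarith⟩
  · exact ⟨le_rfl, by norm_num⟩

variable {o e}

open Classical in
/-- The path of the clique vertex `k`: a horizontal ray if `k` carries the arm to the right, and
otherwise a vertical segment, or the origin alone if `k` carries no arm. -/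
noncomputable def cliqueSeg (he : ∀ d, 0 < e d ∧ e d < 1) (k : V) : Seg ℚ :=
  if o .right = some k then
    ⟨0, reach o e k .right, 0, 0, (reach_nonneg o e he k _).1, le_rfl, .inr rfl⟩
  else
    ⟨0, 0, -reach o e k .down, reach o e k .up, le_rfl, by
      have := (reach_nonneg o e he k .down).1
      have := (reach_nonneg o e he k .up).1
      linarith, .inl rfl⟩

variable (he : ∀ d, 0 < e d ∧ e d < 1)

theorem cliqueSeg_has_zero (k : V) : (cliqueSeg (o := o) he k).Has 0 0 := by
  have h1 := (reach_nonneg o e he k .down).1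
  have h2 := (reach_nonneg o e he k .up).1
  have h3 := (reach_nonneg o e he k .right).1
  unfold cliqueSeg
  split_ifs
  · exact ⟨le_rfl, h3, le_rfl, le_rfl⟩
  · exact ⟨le_rfl, le_rfl, by simpa using h1, h2⟩

theorem cliqueSeg_inBox (k : V) : (cliqueSeg (o := o) he k).InBox (-1) 1 (-1) 1 := by
  have h1 := reach_nonneg o e he k .down
  have h2 := reach_nonneg o e he k .up
  have h3 := reach_nonneg o e he k .right
  unfold cliqueSeg
  split_ifs <;> refine ⟨?_, ?_, ?_, ?_⟩ <;> simp only <;> linarith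

theorem cliqueSeg_meets_turn
    (ho : ∀ k, o .right = some k → o .up ≠ some k ∧ o .down ≠ some k) {k : V} {d : Dir}
    {s : Seg ℚ} (hs : s.InBox 0 1 (-1) 1) :
    (cliqueSeg (o := o) he k).Meets (d.turn s) ↔
      o d = some k ∧ s.a ≤ e d ∧ s.c ≤ 0 ∧ 0 ≤ s.d := by
  obtain ⟨s1, s2, s3, s4⟩ := hs
  have hab := s.hab
  have hcd := s.hcd
  have h1 := he .up
  have h2 := he .down
  have h3 := he .right
  have hk := ho k
  unfold cliqueSeg reach
  by_cases hr : o .right = some k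
  · simp only [if_pos hr]
    cases d
    · simp only [(hk hr).1, false_and, iff_false, Seg.Meets, Dir.turn]
      rintro ⟨_, _, h, _⟩; linarith
    · simp only [(hk hr).2, false_and, iff_false, Seg.Meets, Dir.turn]
      rintro ⟨_, _, _, h⟩; linarith
    · simp only [hr, true_and, Seg.Meets, Dir.turn]
      constructor
      · rintro ⟨h1, h2, h3, h4⟩; refine ⟨?_, ?_, ?_⟩ <;> linarith
      · rintro ⟨h1, h2, h3⟩; refine ⟨?_, ?_, ?_, ?_⟩ <;> linarith
  · simp only [if_neg hr]
    cases d
    · by_cases hu : o .up = some k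
      · simp only [hu, if_true, true_and, Seg.Meets, Dir.turn]
        constructor
        · rintro ⟨h1, h2, h3, h4⟩; refine ⟨?_, ?_, ?_⟩ <;> linarith
        · rintro ⟨h1, h2, h3⟩; refine ⟨?_, ?_, ?_, ?_⟩ <;> (try split_ifs) <;> linarith
      · simp only [hu, if_false, false_and, iff_false, Seg.Meets, Dir.turn]
        rintro ⟨_, _, _, h⟩; linarith
    · by_cases hu : o .down = some k
      · simp only [hu, if_true, true_and, Seg.Meets, Dir.turn]
        constructor
        · rintro ⟨h1, h2, h3, h4⟩; refine ⟨?_, ?_, ?_⟩ <;> linarith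
        · rintro ⟨h1, h2, h3⟩; refine ⟨?_, ?_, ?_, ?_⟩ <;> (try split_ifs) <;> linarith
      · simp only [hu, if_false, false_and, iff_false, Seg.Meets, Dir.turn]
        rintro ⟨_, _, h, _⟩; linarith
    · simp only [hr, false_and, iff_false, Seg.Meets, Dir.turn]
      rintro ⟨_, h, _, _⟩; linarith

end Cross

/-- A clique `K` with arms `A d` attached to its vertices `o d` (if any). The vertices of the clique
pass through the origin; a vertex may carry the arms up and down, being drawn as a vertical segment,
but the vertex carrying the arm to the right carries no other. -/
theorem exists_rep_of_arms {K : Set V} (hK : G.IsClique K) (o : Dir → Option V)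
    (A : Dir → Set V)
    (ho : ∀ k, o .right = some k → o .up ≠ some k ∧ o .down ≠ some k)
    (hA : ∀ d k, o d = some k → Arm G k (A d)) (hA' : ∀ d, o d = none → A d = ∅)
    (hKA : ∀ d, ∀ w ∈ A d, w ∉ K ∧ ∀ k ∈ K, G.Adj k w → o d = some k)
    (hAA : ∀ d d', d ≠ d' → ∀ v ∈ A d, ∀ w ∈ A d', v ≠ w ∧ ¬ G.Adj v w) :
    ∃ R : V → Seg ℚ, RepOn G (K ∪ ⋃ d, A d) R ∧
      (∀ w ∈ K ∪ ⋃ d, A d, (R w).InBox (-1) 1 (-1) 1) ∧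
      (∀ w ∈ K ∪ ⋃ d, A d, (w ∈ K ↔ (R w).a ≤ 0 ∧ (R w).c ≤ 0 ∧ 0 ≤ (R w).d)) ∧
      (o .right = none → ∀ w ∈ K ∪ ⋃ d, A d, (w ∈ K ↔ (R w).c ≤ 0 ∧ 0 ≤ (R w).d)) := by
  classical
  have hArm : ∀ d, ∃ (R : V → Seg ℚ) (e : ℚ), 0 < e ∧ e < 1 ∧ RepOn G (A d) R ∧
      (∀ w ∈ A d, (R w).InBox 0 1 (-1) 1) ∧
      ∀ k, o d = some k → ∀ w ∈ A d, (G.Adj k w ↔ (R w).a ≤ e ∧ (R w).c ≤ 0 ∧ 0 ≤ (R w).d) := by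
    intro d
    cases hd : o d with
    | none =>
      have := hA' d hd
      exact ⟨fun _ => Seg.point 0 0, 1 / 2, by norm_num, by norm_num, by simp [RepOn, this],
        by simp [this], by simp⟩
    | some k =>
      obtain ⟨R, e, h1, h2, h3, h4, h5⟩ := hA d k hd
      refine ⟨R, e, h1, h2, h3, h4, ?_⟩
      rintro k' h
      cases h
      exact h5
  choose R e he0 he1 hR hbox hadj using hArm
  have he : ∀ d, 0 < e d ∧ e d < 1 := fun d => ⟨he0 d, he1 d⟩
  let Q : V → Seg ℚ := fun w =>
    if h : ∃ d, w ∈ A d then h.choose.turn (R h.choose w) else cliqueSeg (o := o) he w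
  have hQK : ∀ k ∈ K, Q k = cliqueSeg (o := o) he k := fun k hk =>
    dif_neg fun ⟨d, hd⟩ => (hKA d k hd).1 hk
  have hQA : ∀ d, ∀ w ∈ A d, Q w = d.turn (R d w) := by
    intro d w hw
    have h : ∃ d, w ∈ A d := ⟨d, hw⟩
    have hd : h.choose = d := by
      by_contra hne
      exact (hAA _ _ hne w h.choose_spec w hw).1 rfl
    simp only [Q, dif_pos h, hd]
  have hKm : ∀ k ∈ K, ∀ d, ∀ w ∈ A d, (G.Adj k w ↔ (Q k).Meets (Q w)) := by
    intro k hk d w hw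
    rw [hQK k hk, hQA d w hw, cliqueSeg_meets_turn he ho (hbox d w hw)]
    constructor
    · intro h
      have hd := (hKA d w hw).2 k hk h
      exact ⟨hd, (hadj d k hd w hw).1 h⟩
    · rintro ⟨hd, h⟩
      exact (hadj d k hd w hw).2 h
  simp only [Set.mem_union, Set.mem_iUnion]
  refine ⟨Q, ?_, ?_, ?_, ?_⟩
  · intro v hv w hw hvw
    simp only [Set.mem_union, Set.mem_iUnion] at hv hw
    rcases hv with hv | ⟨d, hv⟩ <;> rcases hw with hw | ⟨d', hw⟩
    · refine iff_of_true (hK hv hw hvw) (Seg.meets_iff.2 ⟨0, 0, ?_, ?_⟩)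
      · rw [hQK v hv]; exact cliqueSeg_has_zero he v
      · rw [hQK w hw]; exact cliqueSeg_has_zero he w
    · exact hKm v hv d' w hw
    · rw [G.adj_comm, Seg.meets_comm]
      exact hKm w hw d v hv
    · by_cases hd : d = d'
      · subst hd
        rw [hQA d v hv, hQA d w hw, Dir.turn_meets]
        exact hR d v hv w hw hvw
      · refine iff_of_false (hAA d d' hd v hv w hw).2 ?_
        rw [hQA d v hv, hQA d' w hw]
        exact Dir.turn_not_meets hd (hbox d v hv) (hbox d' w hw)
  · rintro w (hw | ⟨d, hw⟩)
    · rw [hQK w hw]; exact cliqueSeg_inBox he w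
    · rw [hQA d w hw]; exact Dir.turn_inBox (hbox d w hw)
  · rintro w (hw | ⟨d, hw⟩)
    · rw [hQK w hw]
      have := cliqueSeg_has_zero (o := o) he w
      exact iff_of_true hw ⟨this.1, this.2.2⟩
    · refine iff_of_false (hKA d w hw).1 ?_
      rw [hQA d w hw]
      obtain ⟨b1, b2, b3, b4⟩ := hbox d w hw
      have := (R d w).hab
      rintro ⟨h1, h2, h3⟩
      cases d <;> simp only [Dir.turn] at h1 h2 h3 <;> linarith
  · rintro hr w (hw | ⟨d, hw⟩)
    · rw [hQK w hw]
      exact iff_of_true hw (cliqueSeg_has_zero (o := o) he w).2.2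
    · refine iff_of_false (hKA d w hw).1 ?_
      rw [hQA d w hw]
      obtain ⟨b1, b2, b3, b4⟩ := hbox d w hw
      have := (R d w).hab
      rintro ⟨h2, h3⟩
      cases d
      · simp only [Dir.turn] at h2 h3; linarith
      · simp only [Dir.turn] at h2 h3; linarith
      · simp [hA' _ hr] at hw

end

/-! ### Vertices with a pendant neighbour -/

theorem Nonsep.subset_of_pendant {V : Type*} {G : SimpleGraph V} {v s : V} {T : Set V}
    (hs : ∀ z, G.Adj s z ↔ z = v) (hT : Nonsep G T) (hvT : v ∈ T) (hsT : s ∈ T) : T ⊆ {v, s} := by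
  intro z hz
  by_contra hzn
  simp only [Set.mem_insert_iff, Set.mem_singleton_iff, not_or] at hzn
  have hsv : s ≠ v := ((hs v).2 rfl).ne
  have h := reachable_induce_iff.1 (hT.2.2 v hvT ⟨s, hsT, hsv⟩ ⟨z, hz, hzn.1⟩)
  refine hzn.2 (eq_of_reachable_of_pendant (v := v) (fun z => (hs z).1) ?_).symm
  rw [SimpleGraph.reachable_iff_reflTransGen]
  exact Relation.ReflTransGen.mono (fun p q hpq =>
    SimpleGraph.deleteIncidenceSet_adj.2 ⟨hpq.1, hpq.2.1.2, hpq.2.2.2⟩) _ _ h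

/-- A vertex with a pendant neighbour `s` whose other neighbours form a nonempty clique is a
2-cutpoint, with endblock `{v, s}`. -/
theorem isTwoCutpoint_of_pendant {V : Type*} [Finite V] {G : SimpleGraph V} (hG : G.Connected)
    {v s : V} (hs : ∀ z, G.Adj s z ↔ z = v) (hk : ∃ k, G.Adj v k ∧ k ≠ s)
    (hK : ∀ k k', G.Adj v k → G.Adj v k' → k ≠ s → k' ≠ s → k ≠ k' → G.Adj k k') :
    IsTwoCutpoint G v ∧ IsEndblock G {v, s} := by
  classical
  obtain ⟨k, hvk, hks⟩ := hk
  have hsv : G.Adj s v := (hs v).2 rfl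
  have hcut : IsCutpoint G v := isCutpoint_of_not_reachable hG hsv.ne hvk.ne' fun h =>
    hks (eq_of_reachable_of_pendant (fun z => (hs z).1) h).symm
  have hncut : ¬ IsCutpoint G s := by
    rw [not_isCutpoint_iff hG]
    rintro ⟨p, hp⟩ ⟨q, hq⟩
    refine (reachable_delete_iff hp hq).2 ?_
    have h := reachable_map (K := G.deleteIncidenceSet s) (fun z => if z = s then v else z)
      (fun a b hab => ?_) (hG.preconnected p q)
    · rwa [if_neg (show ¬ p = s from hp), if_neg (show ¬ q = s from hq)] at h
    · by_cases ha : a = s <;> by_cases hb : b = s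
      · rw [if_pos ha, if_pos hb]
      · rw [if_pos ha, if_neg hb, (hs b).1 (ha ▸ hab)]
      · rw [if_neg ha, if_pos hb, (hs a).1 (hb ▸ hab.symm)]
      · rw [if_neg ha, if_neg hb]
        exact (SimpleGraph.deleteIncidenceSet_adj.2 ⟨hab, ha, hb⟩).reachable
  have hblock : IsBlock G {v, s} := by
    obtain ⟨B, hB, hsub⟩ := (Nonsep.of_isClique (G := G) (S := {v, s})
      (SimpleGraph.isClique_pair.2 fun _ => hsv.symm) ⟨v, by simp⟩).exists_isBlock
    rwa [hsub.antisymm (hB.nonsep.subset_of_pendant hs (hsub (by simp)) (hsub (by simp)))]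
  have hend : IsEndblock G {v, s} := by
    refine ⟨hblock, v, ⟨by simp, hcut⟩, ?_⟩
    rintro u ⟨hu, huc⟩
    rcases hu with rfl | rfl
    · rfl
    · exact absurd huc hncut
  obtain ⟨Q, hQ, hsub⟩ := (Nonsep.of_isClique (G := G) (S := {z | z = v ∨ G.Adj v z ∧ z ≠ s})
    (by
      rintro a (rfl | ha) b (rfl | hb) hab
      · exact absurd rfl hab
      · exact hb.1
      · exact ha.1.symm
      · exact hK a b ha.1 hb.1 ha.2 hb.2 hab) ⟨v, .inl rfl⟩).exists_isBlock
  have hvQ : v ∈ Q := hsub (.inl rfl)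
  have hkQ : k ∈ Q := hsub (.inr ⟨hvk, hks⟩)
  have hne : ({v, s} : Set V) ≠ Q := by
    rintro rfl
    rcases hkQ with rfl | rfl
    · exact hvk.ne rfl
    · exact hks rfl
  refine ⟨⟨hcut, ?_, {v, s}, hend, by simp⟩, hend⟩
  rw [show {B : Set V | IsBlock G B ∧ v ∈ B} = {{v, s}, Q} from ?_, Set.ncard_pair hne]
  ext B
  simp only [Set.mem_ofPred_eq, Set.mem_insert_iff, Set.mem_singleton_iff]
  constructor
  · rintro ⟨hB, hvB⟩
    by_cases hz : ∃ z ∈ B, z ≠ v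
    · obtain ⟨z, hz, hzv⟩ := hz
      have h := reachable_induce_iff.1 (hB.nonsep.2.1 ⟨v, hvB⟩ ⟨z, hz⟩)
      rcases h.cases_head with h | ⟨w, ⟨hvw, _, hw⟩, _⟩
      · exact absurd h.symm hzv
      · by_cases hws : w = s
        · subst hws
          exact .inl (hB.eq_of_two_mem hblock hsv.ne ⟨hw, by simp⟩ ⟨hvB, by simp⟩)
        · exact .inr (hB.eq_of_two_mem hQ hvw.ne ⟨hvB, hvQ⟩ ⟨hw, hsub (.inr ⟨hvw, hws⟩)⟩)
    · push Not at hz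
      have hBQ : B ⊆ Q := fun z hzB => hz z hzB ▸ hvQ
      exact .inr (hBQ.antisymm ((isBlock_iff.1 hB).le_of_ge (isBlock_iff.1 hQ).prop hBQ))
  · rintro (rfl | rfl)
    · exact ⟨hblock, by simp⟩
    · exact ⟨hQ, hvQ⟩

/-- One application of the procedure at two vertices with pendant neighbours. -/
theorem FamilyF.step_of_pendants {W : Type} {F : SimpleGraph W} (hF : FamilyF F) {v s : Bool → W}
    (hv : F.Adj (v false) (v true)) (hs : ∀ i z, F.Adj (s i) z ↔ z = v i) {a b : W}
    (hab : F.Adj a b) (ha : ∀ i, F.Adj a (v i)) (hb : ∀ i, F.Adj b (v i))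
    (has : ∀ i, a ≠ s i)
    (hK : ∀ i k k', F.Adj (v i) k → F.Adj (v i) k' → k ≠ s i → k' ≠ s i → k ≠ k' → F.Adj k k') :
    FamilyF (BlockVPG.step F (v false) (v true) {v false, s false} {v true, s true}) := by
  classical
  have := hF.finBlockGraph.finite
  have h := fun i => isTwoCutpoint_of_pendant hF.finBlockGraph.connected (hs i)
    ⟨a, (ha i).symm, has i⟩ (hK i)
  refine FamilyF.step hF {v false, v true, a, b} ?_ _ _ hv.ne (by simp) (by simp) (h false).1
    (h true).1 _ _ (h false).2 (h true).2 (by simp) (by simp)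
  have h3 : F.IsNClique 3 {v true, a, b} :=
    SimpleGraph.is3Clique_triple_iff.2 ⟨(ha _).symm, (hb _).symm, hab⟩
  refine h3.insert fun c hc => ?_
  simp only [Finset.mem_insert, Finset.mem_singleton] at hc
  rcases hc with rfl | rfl | rfl
  · exact hv
  · exact (ha _).symm
  · exact (hb _).symm

/-! ### The shape of the family: cubic trees of branches -/

/-- The recursive shape of a branch that needs an end of the path of its root. -/
inductive BranchTree
  | leaf
  | node (l r : BranchTree)

/-- The vertices, other than the root, of the branch of shape `t`. In the branch of shape `leaf` the
root belongs to a complete block on four vertices, the others (`core`) having pendant neighbours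
(`pend`). In the branch of shape `node l r` it belongs to a triangle with `c` and `y`, where `c` has
the pendant neighbour `s`, and `y` is the root of branches of the shapes `l` and `r`. -/
inductive BranchVertex : BranchTree → Type
  | core (i : Fin 3) : BranchVertex .leaf
  | pend (i : Fin 3) : BranchVertex .leaf
  | c {l r : BranchTree} : BranchVertex (.node l r)
  | s {l r : BranchTree} : BranchVertex (.node l r)
  | y {l r : BranchTree} : BranchVertex (.node l r)
  | left {l r : BranchTree} (z : BranchVertex l) : BranchVertex (.node l r)
  | right {l r : BranchTree} (z : BranchVertex r) : BranchVertex (.node l r)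

/-- The neighbours of the root in a branch. -/
def BranchVertex.Top : {t : BranchTree} → BranchVertex t → Prop
  | _, .core _ => True
  | _, .c => True
  | _, .y => True
  | _, _ => False

/-- Adjacency within a branch, without its root. -/
def BranchVertex.Adj : {t : BranchTree} → BranchVertex t → BranchVertex t → Prop
  | _, .core i, .core j => i ≠ j
  | _, .core i, .pend j => i = j
  | _, .pend i, .core j => i = j
  | _, .c, .y => True
  | _, .y, .c => True
  | _, .c, .s => True
  | _, .s, .c => True
  | _, .y, .left z => z.Top
  | _, .left z, .y => z.Top
  | _, .y, .right z => z.Top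
  | _, .right z, .y => z.Top
  | _, .left z, .left z' => z.Adj z'
  | _, .right z, .right z' => z.Adj z'
  | _, _, _ => False

theorem BranchVertex.Adj.symm {t : BranchTree} {z z' : BranchVertex t} (h : z.Adj z') :
    z'.Adj z := by
  induction t with
  | leaf => cases z <;> cases z' <;> simp_all [BranchVertex.Adj, eq_comm]
  | node l r ihl ihr =>
    cases z <;> cases z' <;> simp only [BranchVertex.Adj] at h ⊢ <;>
      first | exact h | exact ihl h | exact ihr h

theorem BranchVertex.Adj.irrefl {t : BranchTree} (z : BranchVertex t) : ¬ z.Adj z := by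
  induction t with
  | leaf => cases z <;> simp [BranchVertex.Adj]
  | node l r ihl ihr =>
    cases z <;> simp only [BranchVertex.Adj, not_false_eq_true] <;> first | exact ihl _ | exact ihr _

/-- The vertices of the graph consisting of three branches with a common root. -/
inductive TriVertex (t₁ t₂ t₃ : BranchTree)
  | root
  | fst (z : BranchVertex t₁)
  | snd (z : BranchVertex t₂)
  | trd (z : BranchVertex t₃)

/-- Three branches with a common root. -/
def triGraph (t₁ t₂ t₃ : BranchTree) : SimpleGraph (TriVertex t₁ t₂ t₃) where
  Adj a b := match a, b with
    | .root, .fst z => z.Top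
    | .root, .snd z => z.Top
    | .root, .trd z => z.Top
    | .fst z, .root => z.Top
    | .snd z, .root => z.Top
    | .trd z, .root => z.Top
    | .fst z, .fst z' => z.Adj z'
    | .snd z, .snd z' => z.Adj z'
    | .trd z, .trd z' => z.Adj z'
    | _, _ => False
  symm := ⟨by
    rintro (_ | _ | _ | _) (_ | _ | _ | _) h <;> first | exact h | exact h.symm⟩
  loopless := ⟨by
    rintro (_ | _ | _ | _) h
    · exact h
    all_goals exact BranchVertex.Adj.irrefl _ h⟩

/-- The graph `triGraph t₁ t₂ t₃` belongs, up to isomorphism, to the family. -/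
def InFamily (t₁ t₂ t₃ : BranchTree) : Prop :=
  ∃ (W : Type) (F : SimpleGraph W), FamilyF F ∧ Nonempty (triGraph t₁ t₂ t₃ ≃g F)

theorem InFamily.of_iso {t₁ t₂ t₃ t₁' t₂' t₃' : BranchTree} (h : InFamily t₁ t₂ t₃)
    (e : triGraph t₁' t₂' t₃' ≃g triGraph t₁ t₂ t₃) : InFamily t₁' t₂' t₃' := by
  obtain ⟨W, F, hF, ⟨f⟩⟩ := h
  exact ⟨W, F, hF, ⟨e.trans f⟩⟩

theorem InFamily.rotate {t₁ t₂ t₃ : BranchTree} (h : InFamily t₁ t₂ t₃) : InFamily t₂ t₃ t₁ :=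
  h.of_iso
    { toFun := fun z => match z with
        | .root => .root
        | .fst z => .snd z
        | .snd z => .trd z
        | .trd z => .fst z
      invFun := fun z => match z with
        | .root => .root
        | .fst z => .trd z
        | .snd z => .fst z
        | .trd z => .snd z
      left_inv := by rintro (_ | _ | _ | _) <;> rfl
      right_inv := by rintro (_ | _ | _ | _) <;> rfl
      map_rel_iff' := by rintro (_ | _ | _ | _) (_ | _ | _ | _) <;> exact Iff.rfl }

/-- The root may be moved to the neighbouring branching vertex. -/
theorem InFamily.reroot {l r t₂ t₃ : BranchTree} (h : InFamily l r (.node t₂ t₃)) :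
    InFamily (.node l r) t₂ t₃ :=
  h.of_iso
    { toFun := fun z => match z with
        | .root => .trd .y
        | .fst .c => .trd .c
        | .fst .s => .trd .s
        | .fst .y => .root
        | .fst (.left z) => .fst z
        | .fst (.right z) => .snd z
        | .snd z => .trd (.left z)
        | .trd z => .trd (.right z)
      invFun := fun z => match z with
        | .trd .y => .root
        | .trd .c => .fst .c
        | .trd .s => .fst .s
        | .root => .fst .y
        | .fst z => .fst (.left z)
        | .snd z => .fst (.right z)
        | .trd (.left z) => .snd z
        | .trd (.right z) => .trd z
      left_inv := by rintro (_ | (_ | _ | _ | _ | _) | _ | _) <;> rfl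
      right_inv := by rintro (_ | _ | _ | (_ | _ | _ | _ | _)) <;> rfl
      map_rel_iff' := by
        rintro (_ | (_ | _ | _ | _ | _) | _ | _) (_ | (_ | _ | _ | _ | _) | _ | _) <;>
          exact Iff.rfl }

/-- The vertices of a branch of shape `leaf` as vertices of a thin spider. -/
def leafVertex : BranchVertex .leaf → Fin 3 ⊕ Fin 3
  | .core i => .inl i
  | .pend i => .inr i

theorem leafVertex_adj (z z' : BranchVertex .leaf) :
    (thinSpider 3).Adj (leafVertex z) (leafVertex z') ↔ z.Adj z' := by
  cases z <;> cases z' <;> simp [leafVertex, BranchVertex.Adj]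

theorem leafVertex_injective : Function.Injective leafVertex := by
  rintro (_ | _) (_ | _) h <;> simp_all [leafVertex]

theorem exists_leafVertex (s : Fin 3 ⊕ Fin 3) : ∃ z, leafVertex z = s := by
  rcases s with i | i
  · exact ⟨.core i, rfl⟩
  · exact ⟨.pend i, rfl⟩

theorem exists_iso_of_bijective {V W : Type*} {G : SimpleGraph V} {H : SimpleGraph W} (f : V → W)
    (hf : Function.Bijective f) (h : ∀ a b, H.Adj (f a) (f b) ↔ G.Adj a b) : Nonempty (G ≃g H) :=
  ⟨⟨Equiv.ofBijective f hf, fun {a b} => h a b⟩⟩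

theorem step_x_leafVertex {W : Type} {G : SimpleGraph W} {v₁ v₂ : W} {B₁ B₂ : Set W} {i : Bool}
    (z : BranchVertex .leaf) :
    (step G v₁ v₂ B₁ B₂).Adj .x (.spider i (leafVertex z)) ↔ z.Top := by
  cases z <;> simp [leafVertex, BranchVertex.Top]

theorem step_leafVertex_x {W : Type} {G : SimpleGraph W} {v₁ v₂ : W} {B₁ B₂ : Set W} {i : Bool}
    (z : BranchVertex .leaf) :
    (step G v₁ v₂ B₁ B₂).Adj (.spider i (leafVertex z)) .x ↔ z.Top := by
  rw [SimpleGraph.adj_comm, step_x_leafVertex]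

/-- Contracting two clique vertices of the thin spider of size five. -/
theorem inFamily_leaf : InFamily .leaf .leaf .leaf := by
  let v : Bool → Fin 5 ⊕ Fin 5 := fun i => .inl (bif i then 1 else 0)
  let s : Bool → Fin 5 ⊕ Fin 5 := fun i => .inr (bif i then 1 else 0)
  have hF := FamilyF.base.step_of_pendants (v := v) (s := s) (a := .inl 2) (b := .inl 3)
    (by simp [v]) (by rintro i (z | z) <;> simp [v, s, eq_comm]) (by simp)
    (by rintro (_ | _) <;> simp [v]) (by rintro (_ | _) <;> simp [v]) (by simp [s])
    (by
      rintro i (k | k) (k' | k') h1 h2 h3 h4 h5 <;> simp_all [v, s])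
  obtain ⟨g, hg, hg0, hg1, hsurj⟩ : ∃ g : Fin 3 → Fin 5, Function.Injective g ∧ (∀ i, g i ≠ 0) ∧
      (∀ i, g i ≠ 1) ∧ ∀ j, j ≠ 0 → j ≠ 1 → ∃ i, g i = j :=
    ⟨![2, 3, 4], by decide, by decide, by decide, by decide⟩
  let f : TriVertex .leaf .leaf .leaf →
      StepVertex {v false, s false} {v true, s true} := fun z => match z with
    | .root => .x
    | .fst (.core i) => .old (.inl (g i)) (by simp [v, s, hg0, hg1])
    | .fst (.pend i) => .old (.inr (g i)) (by simp [v, s, hg0, hg1])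
    | .snd z => .spider false (leafVertex z)
    | .trd z => .spider true (leafVertex z)
  refine ⟨_, _, hF, exists_iso_of_bijective f ⟨?_, ?_⟩ ?_⟩
  · rintro (_ | (_ | _) | _ | _) (_ | (_ | _) | _ | _) h <;>
      simp_all [f, leafVertex_injective.eq_iff, hg.eq_iff]
  · rintro (⟨w | w, hw⟩ | _ | ⟨i, z⟩)
    · obtain ⟨j, rfl⟩ := hsurj w (by rintro rfl; simp [v] at hw) (by rintro rfl; simp [v] at hw)
      exact ⟨.fst (.core j), rfl⟩
    · obtain ⟨j, rfl⟩ := hsurj w (by rintro rfl; simp [s] at hw) (by rintro rfl; simp [s] at hw)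
      exact ⟨.fst (.pend j), rfl⟩
    · exact ⟨.root, rfl⟩
    · obtain ⟨z, rfl⟩ := exists_leafVertex z
      cases i
      · exact ⟨.snd z, rfl⟩
      · exact ⟨.trd z, rfl⟩
  · rintro (_ | (_ | _) | _ | _) (_ | (_ | _) | _ | _)
    all_goals simp only [f, triGraph, BranchVertex.Adj, BranchVertex.Top, leafVertex_adj,
      step_x_leafVertex, step_leafVertex_x, step_spider_spider, step_old_old, step_old_x,
      step_x_old, step_old_spider, step_spider_old]
    all_goals simp [v, hg.eq_iff, hg0, hg1]

/-- Contracting two of the three vertices with pendant neighbours in a branch of shape `leaf`. -/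
theorem InFamily.node_leaf_leaf {l r : BranchTree} (h : InFamily .leaf l r) :
    InFamily (.node .leaf .leaf) l r := by
  obtain ⟨W, F, hF, ⟨e⟩⟩ := h
  have hadj : ∀ a b, F.Adj (e a) (e b) ↔ (triGraph .leaf l r).Adj a b := fun a b =>
    e.map_adj_iff
  let k : Bool → Fin 3 := fun i => bif i then 1 else 0
  let v : Bool → W := fun i => e (.fst (.core (k i)))
  let s : Bool → W := fun i => e (.fst (.pend (k i)))
  have hF' := hF.step_of_pendants (v := v) (s := s) (a := e .root) (b := e (.fst (.core 2)))
    (by simp only [v, hadj]; simp [triGraph, BranchVertex.Adj, k])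
    (by
      intro i z
      obtain ⟨z, rfl⟩ := e.surjective z
      rw [hadj, e.injective.eq_iff]
      rcases z with _ | (_ | _) | _ | _ <;> simp [triGraph, BranchVertex.Adj, BranchVertex.Top,
        eq_comm])
    (by rw [hadj]; simp [triGraph, BranchVertex.Top])
    (by intro i; rw [hadj]; simp [triGraph, BranchVertex.Top])
    (by rintro (_ | _) <;> rw [hadj] <;> simp [triGraph, BranchVertex.Adj, k])
    (by intro i h; simpa using e.injective h)
    (by
      intro i a b
      obtain ⟨a, rfl⟩ := e.surjective a
      obtain ⟨b, rfl⟩ := e.surjective b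
      simp only [v, s, hadj, e.injective.ne_iff]
      rcases a with _ | (_ | _) | _ | _ <;> rcases b with _ | (_ | _) | _ | _ <;>
        simp only [triGraph, BranchVertex.Adj, BranchVertex.Top, false_imp_iff, true_imp_iff,
          imp_true_iff, ne_eq, not_true_eq_false]
      all_goals (clear hadj; intros; simp_all))
  have hout : ∀ z, (∀ i, z ≠ .fst (.core (k i)) ∧ z ≠ .fst (.pend (k i))) →
      e z ∉ ({v false, s false} : Set W) ∪ {v true, s true} := by
    intro z hz
    simp only [Set.mem_union, Set.mem_insert_iff, Set.mem_singleton_iff, v, s,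
      e.injective.eq_iff]
    rintro ((h | h) | (h | h))
    exacts [(hz _).1 h, (hz _).2 h, (hz _).1 h, (hz _).2 h]
  have hk : ∀ i, (2 : Fin 3) ≠ k i := by rintro (_ | _) <;> simp [k]
  let f : TriVertex (.node .leaf .leaf) l r →
      StepVertex {v false, s false} {v true, s true} := fun z => match z with
    | .root => .old (e .root) (hout _ (by simp))
    | .fst .c => .old (e (.fst (.core 2))) (hout _ (by simp [hk]))
    | .fst .s => .old (e (.fst (.pend 2))) (hout _ (by simp [hk]))
    | .fst .y => .x
    | .fst (.left z) => .spider false (leafVertex z)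
    | .fst (.right z) => .spider true (leafVertex z)
    | .snd z => .old (e (.snd z)) (hout _ (by simp))
    | .trd z => .old (e (.trd z)) (hout _ (by simp))
  refine ⟨_, _, hF', exists_iso_of_bijective f ⟨?_, ?_⟩ ?_⟩
  · rintro (_ | (_ | _ | _ | _ | _) | _ | _) (_ | (_ | _ | _ | _ | _) | _ | _) h
    all_goals simp only [f, reduceCtorEq, StepVertex.old.injEq, StepVertex.spider.injEq,
      e.injective.eq_iff, leafVertex_injective.eq_iff, TriVertex.fst.injEq, TriVertex.snd.injEq,
      TriVertex.trd.injEq, false_and, true_and] at h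
    all_goals first | rfl | rw [h]
  · have h3 : ∀ j : Fin 3, j = k false ∨ j = k true ∨ j = 2 := by decide
    rintro (⟨w, hw⟩ | _ | ⟨i, z⟩)
    · obtain ⟨w, rfl⟩ := e.surjective w
      rcases w with _ | (j | j) | z | z
      · exact ⟨.root, rfl⟩
      · rcases h3 j with rfl | rfl | rfl
        · simp [v] at hw
        · simp [v] at hw
        · exact ⟨.fst .c, rfl⟩
      · rcases h3 j with rfl | rfl | rfl
        · simp [s] at hw
        · simp [s] at hw
        · exact ⟨.fst .s, rfl⟩
      · exact ⟨.snd z, rfl⟩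
      · exact ⟨.trd z, rfl⟩
    · exact ⟨.fst .y, rfl⟩
    · obtain ⟨z, rfl⟩ := exists_leafVertex z
      cases i
      · exact ⟨.fst (.left z), rfl⟩
      · exact ⟨.fst (.right z), rfl⟩
  · rintro (_ | (_ | _ | _ | _ | _) | _ | _) (_ | (_ | _ | _ | _ | _) | _ | _)
    all_goals first
      | exact step_old_old.trans (hadj _ _)
      | exact iff_of_false step_old_spider id
      | exact iff_of_false step_spider_old id
      | exact step_x_leafVertex _
      | exact step_leafVertex_x _
      | exact step_spider_spider.trans ((and_iff_right rfl).trans (leafVertex_adj _ _))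
      | exact iff_of_false (fun h => Bool.noConfusion (step_spider_spider.1 h).1) id
      | exact iff_of_false (SimpleGraph.irrefl _) id
      | exact (step_old_old.trans (hadj _ _)).trans (iff_of_true rfl trivial)
      | exact (step_old_old.trans (hadj _ _)).trans (iff_of_false (fun h => h rfl) id)
      | exact (step_old_x.trans (or_congr (hadj _ _) (hadj _ _))).trans
          (iff_of_true (.inl trivial) trivial)
      | exact (step_x_old.trans (or_congr (hadj _ _) (hadj _ _))).trans
          (iff_of_true (.inl trivial) trivial)
      | exact (step_old_x.trans (or_congr (hadj _ _) (hadj _ _))).trans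
          (iff_of_false (fun h => h.elim id id) id)
      | exact (step_x_old.trans (or_congr (hadj _ _) (hadj _ _))).trans
          (iff_of_false (fun h => h.elim id id) id)
      | exact (step_old_x.trans (or_congr (hadj _ _) (hadj _ _))).trans
          (iff_of_true (.inl (hk false)) trivial)
      | exact (step_x_old.trans (or_congr (hadj _ _) (hadj _ _))).trans
          (iff_of_true (.inl (hk false)) trivial)
      | exact (step_old_x.trans (or_congr (hadj _ _) (hadj _ _))).trans
          (iff_of_false (fun h => h.elim (hk false) (hk true)) id)
      | exact (step_x_old.trans (or_congr (hadj _ _) (hadj _ _))).trans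
          (iff_of_false (fun h => h.elim (hk false) (hk true)) id)

/-- The number of inner nodes. -/
def BranchTree.size : BranchTree → ℕ
  | .leaf => 0
  | .node l r => l.size + r.size + 1

/-- Every graph consisting of three branches with a common root belongs to the family: the root is
moved to a branching vertex that carries two branches of shape `leaf`, where the last application of
the procedure can be undone. -/
theorem inFamily (t₁ t₂ t₃ : BranchTree) : InFamily t₁ t₂ t₃ := by
  suffices h : ∀ n, ∀ t₁ t₂ t₃ : BranchTree, t₁.size + t₂.size + t₃.size = n →
      InFamily t₁ t₂ t₃ from h _ _ _ _ rfl
  intro n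
  induction n with
  | zero =>
    intro t₁ t₂ t₃ h
    rcases t₁ with _ | ⟨l₁, r₁⟩
    · rcases t₂ with _ | ⟨l₂, r₂⟩
      · rcases t₃ with _ | ⟨l₃, r₃⟩
        · exact inFamily_leaf
        · simp [BranchTree.size] at h
      · simp [BranchTree.size] at h
    · simp [BranchTree.size] at h
  | succ n ih =>
    have key : ∀ t t₂ t₃ : BranchTree, t.size + t₂.size + t₃.size = n + 1 → t ≠ .leaf →
        InFamily t t₂ t₃ := by
      intro t
      induction t with
      | leaf => intro _ _ _ h; exact absurd rfl h
      | node l r ihl ihr =>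
        intro t₂ t₃ h _
        simp only [BranchTree.size] at h
        by_cases hl : l = .leaf
        · by_cases hr : r = .leaf
          · subst hl hr
            simp only [BranchTree.size] at h
            exact (ih _ _ _ (by simp only [BranchTree.size]; omega)).node_leaf_leaf
          · exact InFamily.reroot (ihr _ _ (by simp only [BranchTree.size]; omega)
              hr).rotate.rotate
        · exact InFamily.reroot (ihl _ _ (by simp only [BranchTree.size]; omega) hl)
    intro t₁ t₂ t₃ h
    by_cases h1 : t₁ = .leaf
    · by_cases h2 : t₂ = .leaf
      · have h3 : t₃ ≠ .leaf := by
          rintro rfl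
          subst h1 h2
          simp [BranchTree.size] at h
        exact (key t₃ t₁ t₂ (by omega) h3).rotate
      · exact (key t₂ t₃ t₁ (by omega) h2).rotate.rotate
    · exact key t₁ t₂ t₃ h h1

section

variable {V : Type u} {G : SimpleGraph V}

/-! ### Components after the removal of a vertex -/

/-- The component of `a` in the graph with `v` removed. -/
def comp (G : SimpleGraph V) (v a : V) : Set V := {w | (G.deleteIncidenceSet v).Reachable a w}

/-- The two sets are disjoint and no edge joins them. -/
def Apart (G : SimpleGraph V) (S T : Set V) : Prop := ∀ x ∈ S, ∀ y ∈ T, x ≠ y ∧ ¬ G.Adj x y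

theorem Apart.symm {S T : Set V} (h : Apart G S T) : Apart G T S :=
  fun x hx y hy => ⟨(h y hy x hx).1.symm, fun hxy => (h y hy x hx).2 hxy.symm⟩

theorem mem_comp_self (v a : V) : a ∈ comp G v a := SimpleGraph.Reachable.refl _

theorem mem_comp_comm {v a b : V} : b ∈ comp G v a ↔ a ∈ comp G v b :=
  ⟨SimpleGraph.Reachable.symm, SimpleGraph.Reachable.symm⟩

theorem comp_eq {v a b : V} (h : b ∈ comp G v a) : comp G v b = comp G v a :=
  Set.ext fun _ => ⟨fun h' => SimpleGraph.Reachable.trans h h',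
    fun h' => SimpleGraph.Reachable.trans (SimpleGraph.Reachable.symm h) h'⟩

theorem mem_comp_of_adj {v a w z : V} (hw : w ∈ comp G v a) (hwz : G.Adj w z) (hwv : w ≠ v)
    (hzv : z ≠ v) : z ∈ comp G v a :=
  SimpleGraph.Reachable.trans hw
    (SimpleGraph.deleteIncidenceSet_adj.2 ⟨hwz, hwv, hzv⟩).reachable

theorem comp_eq_of_adj {v a b : V} (h : G.Adj a b) (ha : a ≠ v) (hb : b ≠ v) :
    comp G v a = comp G v b :=
  (comp_eq (mem_comp_of_adj (mem_comp_self v a) h ha hb)).symm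

theorem comp_induction {v a : V} {p : V → Prop} (h0 : p a)
    (h : ∀ w z, w ∈ comp G v a → p w → G.Adj w z → w ≠ v → z ≠ v → p z) {w : V}
    (hw : w ∈ comp G v a) : p w := by
  have hw' := (SimpleGraph.reachable_iff_reflTransGen _ _).1 hw
  clear hw
  induction hw' with
  | refl => exact h0
  | @tail w z h1 h2 ih =>
    rw [SimpleGraph.deleteIncidenceSet_adj] at h2
    exact h w z ((SimpleGraph.reachable_iff_reflTransGen _ _).2 h1) ih h2.1 h2.2.1 h2.2.2

theorem ne_of_mem_comp {v a w : V} (ha : a ≠ v) (hw : w ∈ comp G v a) : w ≠ v :=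
  comp_induction (p := fun w => w ≠ v) ha (fun _ _ _ _ _ _ hz => hz) hw

theorem not_adj_of_mem_comp {v a x y : V} (ha : a ≠ v) (hx : x ∈ comp G v a)
    (hy : y ∉ comp G v a) (hyv : y ≠ v) : x ≠ y ∧ ¬ G.Adj x y :=
  ⟨fun h => hy (h ▸ hx), fun h => hy (mem_comp_of_adj hx h (ne_of_mem_comp ha hx) hyv)⟩

/-- A component at `a` that avoids `v` survives the removal of `v` instead of `a`. -/
theorem comp_subset {v a b : V} (hv : v ∉ comp G a b) :
    comp G a b ⊆ comp G v b := by
  intro w hw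
  refine comp_induction (p := fun w => w ∈ comp G v b) (mem_comp_self v b) ?_ hw
  intro w z hw hwv hwz hwa hza
  exact mem_comp_of_adj hwv hwz (fun h => hv (h ▸ hw))
    (fun h => hv (h ▸ mem_comp_of_adj hw hwz hwa hza))

theorem apart_comp {v a b : V} (ha : a ≠ v) (hb : b ≠ v) (h : b ∉ comp G v a) :
    Apart G (comp G v a) (comp G v b) :=
  fun _ hx _ hy => not_adj_of_mem_comp ha hx
    (fun hy' => h (comp_eq hy' ▸ mem_comp_comm.1 hy)) (ne_of_mem_comp hb hy)

theorem LocSep.adj_of_mem_comp (hL : LocSep G) {v a b : V} (ha : G.Adj v a) (hb : G.Adj v b)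
    (h : b ∈ comp G v a) (hab : a ≠ b) : G.Adj a b :=
  (hL v a b ha hb h).resolve_left hab

/-- In a connected graph every component left by the removal of `v` contains a neighbour of `v`. -/
theorem exists_adj_mem_comp (hG : G.Connected) {v x : V} (hx : x ≠ v) :
    ∃ b, G.Adj v b ∧ x ∈ comp G v b := by
  have h := (SimpleGraph.reachable_iff_reflTransGen _ _).1 (hG.preconnected v x)
  induction h with
  | refl => exact absurd rfl hx
  | @tail w z _ h2 ih =>
    by_cases hw : w = v
    · subst hw
      exact ⟨z, h2, mem_comp_self _ _⟩
    · obtain ⟨b, hb, hwb⟩ := ih hw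
      exact ⟨b, hb, mem_comp_of_adj hwb h2 hw hx⟩

/-! ### Branches inside a block graph -/

/-- The set `S` contains a branch of shape `t` with root `a` as an induced subgraph. -/
def HasBranch (G : SimpleGraph V) (a : V) (S : Set V) (t : BranchTree) : Prop :=
  ∃ f : BranchVertex t → V, Function.Injective f ∧ (∀ z, f z ∈ S) ∧
    (∀ z z', G.Adj (f z) (f z') ↔ z.Adj z') ∧ ∀ z, G.Adj a (f z) ↔ z.Top

/-- Three branches in different components at `a` form a member of the family. -/
theorem IsFFree.not_three_branches (hF : IsFFree G) {a : V} {S₁ S₂ S₃ : Set V}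
    {t₁ t₂ t₃ : BranchTree} (h₁ : HasBranch G a S₁ t₁) (h₂ : HasBranch G a S₂ t₂)
    (h₃ : HasBranch G a S₃ t₃) (ha₁ : a ∉ S₁) (ha₂ : a ∉ S₂) (ha₃ : a ∉ S₃) (h₁₂ : Apart G S₁ S₂)
    (h₁₃ : Apart G S₁ S₃) (h₂₃ : Apart G S₂ S₃) : False := by
  obtain ⟨f₁, i₁, m₁, e₁, r₁⟩ := h₁
  obtain ⟨f₂, i₂, m₂, e₂, r₂⟩ := h₂
  obtain ⟨f₃, i₃, m₃, e₃, r₃⟩ := h₃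
  have p₁₂ := fun z z' => h₁₂ _ (m₁ z) _ (m₂ z')
  have p₁₃ := fun z z' => h₁₃ _ (m₁ z) _ (m₃ z')
  have p₂₃ := fun z z' => h₂₃ _ (m₂ z) _ (m₃ z')
  have q₁ : ∀ z, a ≠ f₁ z := fun z h => ha₁ (h ▸ m₁ z)
  have q₂ : ∀ z, a ≠ f₂ z := fun z h => ha₂ (h ▸ m₂ z)
  have q₃ : ∀ z, a ≠ f₃ z := fun z h => ha₃ (h ▸ m₃ z)
  obtain ⟨W, F, hFF, ⟨e⟩⟩ := inFamily t₁ t₂ t₃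
  let f : TriVertex t₁ t₂ t₃ → V := fun z => match z with
    | .root => a
    | .fst z => f₁ z
    | .snd z => f₂ z
    | .trd z => f₃ z
  have hadj : ∀ z z', G.Adj (f z) (f z') ↔ (triGraph t₁ t₂ t₃).Adj z z' := by
    rintro (_ | z | z | z) (_ | z' | z' | z')
    · exact iff_of_false (SimpleGraph.irrefl _) id
    · exact r₁ _
    · exact r₂ _
    · exact r₃ _
    · exact (G.adj_comm _ _).trans (r₁ _)
    · exact e₁ _ _
    · exact iff_of_false (p₁₂ _ _).2 id
    · exact iff_of_false (p₁₃ _ _).2 id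
    · exact (G.adj_comm _ _).trans (r₂ _)
    · exact iff_of_false (fun h => (p₁₂ _ _).2 h.symm) id
    · exact e₂ _ _
    · exact iff_of_false (p₂₃ _ _).2 id
    · exact (G.adj_comm _ _).trans (r₃ _)
    · exact iff_of_false (fun h => (p₁₃ _ _).2 h.symm) id
    · exact iff_of_false (fun h => (p₂₃ _ _).2 h.symm) id
    · exact e₃ _ _
  have hinj : Function.Injective f := by
    rintro (_ | z | z | z) (_ | z' | z' | z') h
    · rfl
    · exact absurd h (q₁ _)
    · exact absurd h (q₂ _)
    · exact absurd h (q₃ _)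
    · exact absurd h.symm (q₁ _)
    · exact congrArg _ (i₁ h)
    · exact absurd h (p₁₂ _ _).1
    · exact absurd h (p₁₃ _ _).1
    · exact absurd h.symm (q₂ _)
    · exact absurd h.symm (p₁₂ _ _).1
    · exact congrArg _ (i₂ h)
    · exact absurd h (p₂₃ _ _).1
    · exact absurd h.symm (q₃ _)
    · exact absurd h.symm (p₁₃ _ _).1
    · exact absurd h.symm (p₂₃ _ _).1
    · exact congrArg _ (i₃ h)
  exact hF W F hFF ⟨SimpleGraph.Embedding.comp
    (⟨⟨f, hinj⟩, fun {z z'} => hadj z z'⟩ : triGraph t₁ t₂ t₃ ↪g G) e.symm.toEmbedding⟩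

/-- The vertex `s` is a neighbour of `c` in a component at `c` other than that of `w`. -/
def Pend (G : SimpleGraph V) (c w s : V) : Prop := G.Adj c s ∧ s ∉ comp G c w

theorem Pend.ne {c w s z : V} (h : Pend G c w s) (hz : z ∈ comp G c w) : s ≠ z :=
  fun h' => h.2 (h' ▸ hz)

theorem Pend.not_adj {c w s z : V} (h : Pend G c w s) (hwc : w ≠ c) (hz : z ∈ comp G c w) :
    ¬ G.Adj s z := fun h' =>
  (not_adj_of_mem_comp hwc hz h.2 h.1.ne').2 h'.symm

theorem Pend.of_adj {c w w' s : V} (h : Pend G c w s) (hw : G.Adj w w') (hwc : w ≠ c)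
    (hwc' : w' ≠ c) : Pend G c w' s :=
  ⟨h.1, comp_eq_of_adj hw hwc hwc' ▸ h.2⟩

/-- A clique with neighbours `s i` in other components induces a thin spider. -/
theorem spider_adj {ι : Type*} {c s : ι → V} (hc : ∀ i j, i ≠ j → G.Adj (c i) (c j))
    (hs : ∀ i j, i ≠ j → Pend G (c i) (c j) (s i)) {i j : ι} (hij : i ≠ j) :
    s i ≠ c j ∧ s i ≠ s j ∧ ¬ G.Adj (c j) (s i) ∧ ¬ G.Adj (s i) (s j) := by
  have h := hs i j hij
  have h1 := h.ne (mem_comp_self _ _)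
  have h2 := h.not_adj (hc i j hij).ne' (mem_comp_self _ _)
  have hj := hs j i hij.symm
  have h3 : s j ∈ comp G (c i) (c j) := mem_comp_of_adj (mem_comp_self _ _) hj.1 (hc i j hij).ne'
    (hj.ne (mem_comp_self _ _))
  exact ⟨h1, h.ne h3, fun h' => h2 h'.symm, h.not_adj (hc i j hij).ne' h3⟩

theorem IsFFree.not_spider_five (hF : IsFFree G) {c s : Fin 5 → V}
    (hc : ∀ i j, i ≠ j → G.Adj (c i) (c j)) (hs : ∀ i j, i ≠ j → Pend G (c i) (c j) (s i)) :
    False := by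
  have hsp := fun i j (h : i ≠ j) => spider_adj hc hs h
  have hcs : ∀ i, G.Adj (c i) (s i) := fun i => (hs i (i + 1) (by simp)).1
  refine hF _ _ FamilyF.base ⟨⟨⟨Sum.elim c s, ?_⟩, ?_⟩⟩
  · rintro (i | i) (j | j) h <;> simp only [Sum.elim_inl, Sum.elim_inr] at h <;>
      by_cases hij : i = j
    · rw [hij]
    · exact absurd h (hc i j hij).ne
    · exact absurd (hij ▸ h) (hcs j).ne
    · exact absurd h.symm (hsp j i (Ne.symm hij)).1
    · exact absurd (hij ▸ h) (hcs j).ne'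
    · exact absurd h (hsp i j hij).1
    · rw [hij]
    · exact absurd h (hsp i j hij).2.1
  · have hmain : ∀ a b, G.Adj (Sum.elim c s a) (Sum.elim c s b) ↔ (thinSpider 5).Adj a b := by
      rintro (i | i) (j | j) <;> by_cases hij : i = j
      · subst hij; simp
      · simp [hc i j hij, hij]
      · subst hij; simp [hcs]
      · simp [(hsp j i (Ne.symm hij)).2.2.1, hij]
      · subst hij; simp [(hcs i).symm]
      · simp [hij, G.adj_comm (s i), (hsp i j hij).2.2.1]
      · subst hij; simp
      · simp [(hsp i j hij).2.2.2]
    exact fun {a b} => hmain a b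

/-- A complete subgraph on `a` and `c i`, with each `c i` having a neighbour away from `a`. -/
theorem hasBranch_leaf {a : V} {c s : Fin 3 → V} (ha : ∀ i, G.Adj a (c i))
    (hc : ∀ i j, i ≠ j → G.Adj (c i) (c j)) (hs : ∀ i, Pend G (c i) a (s i)) {S : Set V}
    (hS : ∀ i, comp G a (c i) = S) : HasBranch G a S .leaf := by
  have hsp := fun i j (h : i ≠ j) => spider_adj hc
    (fun i j h => (hs i).of_adj (ha j) (ha i).ne (hc i j h).ne') h
  have hsa : ∀ i, s i ≠ a := fun i => (hs i).ne (mem_comp_self _ _)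
  let f : BranchVertex .leaf → V := fun z => match z with
    | .core i => c i
    | .pend i => s i
  refine ⟨f, ?_, ?_, ?_, ?_⟩
  · rintro (i | i) (j | j) h <;> by_cases hij : i = j
    · rw [hij]
    · exact absurd h (hc i j hij).ne
    · exact absurd (hij ▸ h) (hs j).1.ne
    · exact absurd (Eq.symm h) (hsp j i (Ne.symm hij)).1
    · exact absurd (hij ▸ h) (hs j).1.ne'
    · exact absurd h (hsp i j hij).1
    · rw [hij]
    · exact absurd h (hsp i j hij).2.1
  · rintro (i | i)
    · exact hS i ▸ mem_comp_self _ _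
    · exact hS i ▸ mem_comp_of_adj (mem_comp_self _ _) (hs i).1 (ha i).ne' (hsa i)
  · rintro (i | i) (j | j) <;> by_cases hij : i = j
    · subst hij; simp [f, BranchVertex.Adj]
    · simp [f, BranchVertex.Adj, hc i j hij, hij]
    · subst hij; simp [f, BranchVertex.Adj, (hs i).1]
    · simp [f, BranchVertex.Adj, (hsp j i (Ne.symm hij)).2.2.1, hij]
    · subst hij; simp [f, BranchVertex.Adj, (hs i).1.symm]
    · simp [f, BranchVertex.Adj, hij, G.adj_comm (s i), (hsp i j hij).2.2.1]
    · subst hij; simp [f, BranchVertex.Adj]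
    · simp [f, BranchVertex.Adj, (hsp i j hij).2.2.2]
  · rintro (i | i)
    · exact iff_of_true (ha i) trivial
    · exact iff_of_false (fun h => (hs i).not_adj (ha i).ne (mem_comp_self _ _) h.symm) id

/-- A triangle on `a`, `c` and `y`, with `c` having a neighbour away from `a`, and `y` being the root of
branches in two components away from `a`. -/
theorem hasBranch_node {a c s y b₁ b₂ : V} (hac : G.Adj a c) (hay : G.Adj a y) (hyc : G.Adj y c)
    (hs : Pend G c a s) (hb₁ : Pend G y a b₁) (hb₂ : Pend G y a b₂) (hbb : b₂ ∉ comp G y b₁)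
    {l r : BranchTree} (hl : HasBranch G y (comp G y b₁) l) (hr : HasBranch G y (comp G y b₂) r) :
    HasBranch G a (comp G a y) (.node l r) := by
  obtain ⟨fl, il, ml, el, rl⟩ := hl
  obtain ⟨fr, ir, mr, er, rr⟩ := hr
  have hsy : s ≠ y := hs.ne (mem_comp_of_adj (mem_comp_self _ _) hay hac.ne hyc.ne)
  have hnsy : ¬ G.Adj s y :=
    hs.not_adj hac.ne (mem_comp_of_adj (mem_comp_self _ _) hay hac.ne hyc.ne)
  have hsa : s ≠ a := hs.ne (mem_comp_self _ _)
  have hnsa : ¬ G.Adj s a := hs.not_adj hac.ne (mem_comp_self _ _)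
  have hcy : c ∈ comp G y a := mem_comp_of_adj (mem_comp_self _ _) hac hay.ne hyc.ne'
  have hsy' : s ∈ comp G y a := mem_comp_of_adj hcy hs.1 hyc.ne' hsy
  -- the branches at `y` are apart from the component of `a` at `y`
  have hout : ∀ b, Pend G y a b → ∀ w ∈ comp G y b, w ≠ y ∧ w ∈ comp G a y ∧
      ∀ z ∈ comp G y a, z ≠ w ∧ ¬ G.Adj z w := by
    intro b hb w hw
    refine ⟨ne_of_mem_comp hb.1.ne' hw, ?_, fun z hz => apart_comp hay.ne hb.1.ne' hb.2 z hz w hw⟩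
    have h1 : a ∉ comp G y b := fun h => hb.2 (mem_comp_comm.1 h)
    have h2 := comp_subset h1 hw
    rwa [comp_eq_of_adj hb.1 hay.ne' (hb.ne (mem_comp_self _ _))]
  have hL := fun z => hout b₁ hb₁ _ (ml z)
  have hR := fun z => hout b₂ hb₂ _ (mr z)
  have hLR := fun z z' => apart_comp hb₁.1.ne' hb₂.1.ne' hbb _ (ml z) _ (mr z')
  let f : BranchVertex (.node l r) → V := fun z => match z with
    | .c => c
    | .s => s
    | .y => y
    | .left z => fl z
    | .right z => fr z
  refine ⟨f, ?_, ?_, ?_, ?_⟩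
  · have hcL := fun z => ((hL z).2.2 c hcy).1
    have hcR := fun z => ((hR z).2.2 c hcy).1
    have hsL := fun z => ((hL z).2.2 s hsy').1
    have hsR := fun z => ((hR z).2.2 s hsy').1
    rintro (_ | _ | _ | z | z) (_ | _ | _ | z' | z') h
    · rfl
    · exact absurd h hs.1.ne
    · exact absurd h hyc.ne'
    · exact absurd h (hcL _)
    · exact absurd h (hcR _)
    · exact absurd h hs.1.ne'
    · rfl
    · exact absurd h hsy
    · exact absurd h (hsL _)
    · exact absurd h (hsR _)
    · exact absurd h hyc.ne
    · exact absurd h hsy.symm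
    · rfl
    · exact absurd h (hL _).1.symm
    · exact absurd h (hR _).1.symm
    · exact absurd h (hcL _).symm
    · exact absurd h (hsL _).symm
    · exact absurd h (hL _).1
    · exact congrArg _ (il h)
    · exact absurd h (hLR _ _).1
    · exact absurd h (hcR _).symm
    · exact absurd h (hsR _).symm
    · exact absurd h (hR _).1
    · exact absurd h (hLR _ _).1.symm
    · exact congrArg _ (ir h)
  · have hc : c ∈ comp G a y := mem_comp_of_adj (mem_comp_self _ _) hyc hay.ne' hac.ne'
    rintro (_ | _ | _ | z | z)
    · exact hc
    · exact mem_comp_of_adj hc hs.1 hac.ne' hsa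
    · exact mem_comp_self _ _
    · exact (hL _).2.1
    · exact (hR _).2.1
  · have hcL := fun z => ((hL z).2.2 c hcy).2
    have hcR := fun z => ((hR z).2.2 c hcy).2
    have hsL := fun z => ((hL z).2.2 s hsy').2
    have hsR := fun z => ((hR z).2.2 s hsy').2
    rintro (_ | _ | _ | z | z) (_ | _ | _ | z' | z')
    · exact iff_of_false (SimpleGraph.irrefl _) id
    · exact iff_of_true hs.1 trivial
    · exact iff_of_true hyc.symm trivial
    · exact iff_of_false (hcL _) id
    · exact iff_of_false (hcR _) id
    · exact iff_of_true hs.1.symm trivial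
    · exact iff_of_false (SimpleGraph.irrefl _) id
    · exact iff_of_false hnsy id
    · exact iff_of_false (hsL _) id
    · exact iff_of_false (hsR _) id
    · exact iff_of_true hyc trivial
    · exact iff_of_false (fun h => hnsy h.symm) id
    · exact iff_of_false (SimpleGraph.irrefl _) id
    · exact rl _
    · exact rr _
    · exact iff_of_false (fun h => hcL _ h.symm) id
    · exact iff_of_false (fun h => hsL _ h.symm) id
    · exact (G.adj_comm _ _).trans (rl _)
    · exact el _ _
    · exact iff_of_false (hLR _ _).2 id
    · exact iff_of_false (fun h => hcR _ h.symm) id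
    · exact iff_of_false (fun h => hsR _ h.symm) id
    · exact (G.adj_comm _ _).trans (rr _)
    · exact iff_of_false (fun h => (hLR _ _).2 h.symm) id
    · exact er _ _
  · rintro (_ | _ | _ | z | z)
    · exact iff_of_true hac trivial
    · exact iff_of_false (fun h => hnsa h.symm) id
    · exact iff_of_true hay trivial
    · exact iff_of_false ((hL _).2.2 a (mem_comp_self _ _)).2 id
    · exact iff_of_false ((hR _).2.2 a (mem_comp_self _ _)).2 id

end

section

variable {V : Type u} {G : SimpleGraph V}

/-! ### Collecting the branches at a vertex -/

/-- The component of `b` at `a` can be attached in the middle of the path of `a`; or it can be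
attached at an end of that path and contains a branch of the family, which accounts for the end. -/
def Attachable (G : SimpleGraph V) (a b : V) : Prop :=
  RepMid G a (comp G a b) ∨ RepEnd G a (comp G a b) ∧ ∃ t, HasBranch G a (comp G a b) t

/-- The set `A`, a union of components at `a`, occupies both directions of the path of `a`, and
contains two branches of the family, which account for the two ends. -/
def TwoArms (G : SimpleGraph V) (a : V) (A : Set V) : Prop :=
  (∃ A₁ A₂, A₁ ∪ A₂ = A ∧ Apart G A₁ A₂ ∧ Arm G a A₁ ∧ Arm G a A₂) ∧
    ∃ b₁ b₂, b₁ ∈ A ∧ b₂ ∈ A ∧ G.Adj a b₁ ∧ G.Adj a b₂ ∧ b₂ ∉ comp G a b₁ ∧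
      (∃ t, HasBranch G a (comp G a b₁) t) ∧ ∃ t, HasBranch G a (comp G a b₂) t

/-- The set `A` is a union of components at `a`. -/
def IsCompUnion (G : SimpleGraph V) (a : V) (A : Set V) : Prop :=
  ∀ x ∈ A, x ≠ a ∧ comp G a x ⊆ A

theorem isCompUnion_comp {a b : V} (hb : b ≠ a) : IsCompUnion G a (comp G a b) :=
  fun _ hx => ⟨ne_of_mem_comp hb hx, (comp_eq hx).subset⟩

theorem IsCompUnion.union {a : V} {A B : Set V} (hA : IsCompUnion G a A)
    (hB : IsCompUnion G a B) : IsCompUnion G a (A ∪ B) := by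
  rintro x (hx | hx)
  · exact ⟨(hA x hx).1, (hA x hx).2.trans Set.subset_union_left⟩
  · exact ⟨(hB x hx).1, (hB x hx).2.trans Set.subset_union_right⟩

theorem IsCompUnion.apart {a b : V} {A : Set V} (hA : IsCompUnion G a A) (hb : b ≠ a)
    (hbA : b ∉ A) : Apart G A (comp G a b) := by
  intro x hx y hy
  refine apart_comp (hA x hx).1 hb (fun h => hbA ((hA x hx).2 h)) x (mem_comp_self _ _) y hy

theorem IsCompUnion.sdiff {a b : V} {A : Set V} (hA : IsCompUnion G a A) :
    IsCompUnion G a (A \ comp G a b) := by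
  rintro x ⟨hx, hxb⟩
  refine ⟨(hA x hx).1, fun y hy => ⟨(hA x hx).2 hy, fun hyb => hxb ?_⟩⟩
  rw [← comp_eq hyb]
  exact mem_comp_comm.1 hy

/-- Adding components through which `a` may pass to an arm. -/
theorem Arm.extend [Finite V] (hG : G.Connected) {a : V} {A A₀ : Set V} (hA : IsCompUnion G a A)
    (hA₀ : IsCompUnion G a A₀) (hsub : A₀ ⊆ A) (h : Arm G a A₀)
    (hmid : ∀ b ∈ A, G.Adj a b → b ∉ A₀ → RepMid G a (comp G a b)) : Arm G a A := by
  suffices hs : ∀ n, ∀ A₀ : Set V, (A \ A₀).ncard = n → IsCompUnion G a A₀ → A₀ ⊆ A →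
      Arm G a A₀ → (∀ b ∈ A, G.Adj a b → b ∉ A₀ → RepMid G a (comp G a b)) → Arm G a A from
    hs _ A₀ rfl hA₀ hsub h hmid
  clear hA₀ hsub h hmid A₀
  intro n
  induction n using Nat.strong_induction_on with
  | _ n ih =>
  intro A₀ hn hA₀ hsub h hmid
  by_cases hx : ∃ x ∈ A, x ∉ A₀
  · obtain ⟨x, hxA, hxA₀⟩ := hx
    obtain ⟨b, hab, hxb⟩ := exists_adj_mem_comp hG (hA x hxA).1
    have hbA : b ∈ A := (hA x hxA).2 (mem_comp_comm.1 hxb)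
    have hbA₀ : b ∉ A₀ := fun hb => hxA₀ ((hA₀ b hb).2 hxb)
    have hbsub : comp G a b ⊆ A := (hA b hbA).2
    refine ih _ ?_ (A₀ ∪ comp G a b) rfl (hA₀.union (isCompUnion_comp hab.ne'))
      (Set.union_subset hsub hbsub)
      (h.union (hmid b hbA hab hbA₀) (hA₀.apart hab.ne' hbA₀))
      fun c hc hac hcn => hmid c hc hac fun h => hcn (.inl h)
    rw [← hn]
    refine Set.ncard_lt_ncard ⟨Set.sdiff_subset_sdiff_right Set.subset_union_left, fun hss => ?_⟩
    exact (hss ⟨hxA, hxA₀⟩).2 (.inr hxb)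
  · push Not at hx
    rwa [← hsub.antisymm hx]

/-- At most two components at `a` need an end of the path of `a`, as three of them would contain a
member of the family. -/
theorem arm_or_twoArms [Finite V] (hG : G.Connected) (hF : IsFFree G) {a : V} {A : Set V}
    (hA : IsCompUnion G a A) (h : ∀ b ∈ A, G.Adj a b → Attachable G a b) :
    Arm G a A ∨ TwoArms G a A := by
  by_cases h1 : ∃ b ∈ A, G.Adj a b ∧ ¬ RepMid G a (comp G a b)
  swap
  · push Not at h1
    exact .inl (Arm.extend hG hA (fun x hx => absurd hx (Set.notMem_empty x)) (Set.empty_subset _)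
      (Arm.empty G a) fun b hb hab _ => h1 b hb hab)
  obtain ⟨b₁, hb₁, hab₁, hm₁⟩ := h1
  obtain ⟨he₁, ht₁⟩ := (h b₁ hb₁ hab₁).resolve_left hm₁
  by_cases h2 : ∃ b ∈ A, G.Adj a b ∧ ¬ RepMid G a (comp G a b) ∧ b ∉ comp G a b₁
  swap
  · push Not at h2
    refine .inl (Arm.extend hG hA (isCompUnion_comp hab₁.ne') (hA b₁ hb₁).2 he₁.arm ?_)
    intro b hb hab hbn
    by_contra hm
    exact hbn (h2 b hb hab hm)
  obtain ⟨b₂, hb₂, hab₂, hm₂, hb₁₂⟩ := h2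
  obtain ⟨he₂, ht₂⟩ := (h b₂ hb₂ hab₂).resolve_left hm₂
  refine .inr ⟨⟨A \ comp G a b₂, comp G a b₂, Set.sdiff_union_of_subset (hA b₂ hb₂).2,
    hA.sdiff.apart hab₂.ne' fun h => h.2 (mem_comp_self _ _), ?_, he₂.arm⟩,
    b₁, b₂, hb₁, hb₂, hab₁, hab₂, hb₁₂, ht₁, ht₂⟩
  have hb₂₁ : b₁ ∉ comp G a b₂ := fun h => hb₁₂ (mem_comp_comm.1 h)
  refine Arm.extend hG hA.sdiff (isCompUnion_comp hab₁.ne') (hA.sdiff b₁ ⟨hb₁, hb₂₁⟩).2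
    he₁.arm ?_
  rintro b ⟨hb, hb₂'⟩ hab hb₁'
  by_contra hm
  obtain ⟨t₁, ht₁⟩ := ht₁
  obtain ⟨t₂, ht₂⟩ := ht₂
  obtain ⟨_, t₃, ht₃⟩ := (h b hb hab).resolve_left hm
  exact hF.not_three_branches ht₁ ht₂ ht₃ (fun h => ne_of_mem_comp hab₁.ne' h rfl)
    (fun h => ne_of_mem_comp hab₂.ne' h rfl) (fun h => ne_of_mem_comp hab.ne' h rfl)
    (apart_comp hab₁.ne' hab₂.ne' hb₁₂) (apart_comp hab₁.ne' hab.ne' hb₁')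
    (apart_comp hab₂.ne' hab.ne' hb₂')

/-! ### The part of a block graph hanging at a vertex of a block -/

/-- The vertices in the components at `a` other than that of `v`. -/
def away (G : SimpleGraph V) (a v : V) : Set V := {x | x ≠ a ∧ x ∉ comp G a v}

theorem isCompUnion_away (a v : V) : IsCompUnion G a (away G a v) := by
  rintro x ⟨hx, hxv⟩
  refine ⟨hx, fun y hy => ⟨ne_of_mem_comp hx hy, fun hyv => hxv ?_⟩⟩
  rw [← comp_eq hyv]
  exact mem_comp_comm.1 hy

section Hanging

variable {v u : V}

/-- The neighbours of `v` in its branch at `u`. -/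
def inner (G : SimpleGraph V) (v u : V) : Set V := {k | G.Adj v k ∧ k ∈ comp G v u}

theorem inner_adj (hL : LocSep G) {k k' : V} (hk : k ∈ inner G v u) (hk' : k' ∈ inner G v u)
    (hne : k ≠ k') : G.Adj k k' :=
  hL.adj_of_mem_comp hk.1 hk'.1 (comp_eq hk.2 ▸ hk'.2) hne

theorem mem_inner_comp {k k' : V} (hk : k ∈ inner G v u) (hk' : k' ∈ inner G v u)
    (hne : k' ≠ k) : k' ∈ comp G k v :=
  mem_comp_of_adj (mem_comp_self _ _) hk'.1 hk.1.ne hne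

theorem comp_subset_of_away {k b : V} (hk : k ∈ inner G v u) (hb : Pend G k v b) :
    comp G k b ⊆ comp G v u := by
  have h1 : v ∉ comp G k b := fun h => hb.2 (mem_comp_comm.1 h)
  have h2 : b ≠ v := hb.ne (mem_comp_self _ _)
  refine (comp_subset h1).trans ?_
  rw [← comp_eq_of_adj hb.1 hk.1.ne' h2, comp_eq hk.2]

theorem exists_pend_mem_comp (hG : G.Connected) {k x : V} (hx : x ∈ away G k v) :
    ∃ b, Pend G k v b ∧ x ∈ comp G k b := by
  obtain ⟨b, hkb, hxb⟩ := exists_adj_mem_comp hG hx.1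
  exact ⟨b, ⟨hkb, fun hb => hx.2 (comp_eq hb ▸ hxb)⟩, hxb⟩

theorem exists_pend_of_away (hG : G.Connected) {k : V} (h : (away G k v).Nonempty) :
    ∃ s, Pend G k v s := by
  obtain ⟨_, hx⟩ := h
  obtain ⟨b, hb, _⟩ := exists_pend_mem_comp hG hx
  exact ⟨b, hb⟩

theorem away_subset (hG : G.Connected) {k : V} (hk : k ∈ inner G v u) :
    away G k v ⊆ comp G v u := by
  intro x hx
  obtain ⟨b, hb, hxb⟩ := exists_pend_mem_comp hG hx
  exact comp_subset_of_away hk hb hxb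

theorem mem_inner_or_away (hL : LocSep G) (hvu : G.Adj v u) {x : V} (hx : x ∈ comp G v u) :
    x ∈ inner G v u ∨ ∃ k ∈ inner G v u, x ∈ away G k v := by
  have h : x ∈ comp G v u ∧ (x ∈ inner G v u ∨ ∃ k ∈ inner G v u, x ∈ away G k v) := by
    refine comp_induction (p := fun x => x ∈ comp G v u ∧
      (x ∈ inner G v u ∨ ∃ k ∈ inner G v u, x ∈ away G k v))
      ⟨mem_comp_self _ _, .inl ⟨hvu, mem_comp_self _ _⟩⟩ ?_ hx
    rintro w z _ ⟨hw, hw'⟩ hwz hwv hzv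
    have hz := mem_comp_of_adj hw hwz hwv hzv
    refine ⟨hz, ?_⟩
    rcases hw' with hwK | ⟨k, hk, hwk⟩
    · by_cases hzw : z ∈ comp G w v
      · exact .inl ⟨hL.adj_of_mem_comp hwK.1.symm hwz hzw hzv.symm, hz⟩
      · exact .inr ⟨w, hwK, hwz.ne', hzw⟩
    · by_cases hzk : z = k
      · exact .inl (hzk ▸ hk)
      · refine .inr ⟨k, hk, hzk, fun h => hwk.2 ?_⟩
        exact mem_comp_of_adj h hwz.symm hzk hwk.1
  exact h.2

/-- What hangs at `k` lies, as seen from another vertex `k'` of the block, on the side of `v`. -/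
theorem away_apart (hG : G.Connected) {k k' : V} (hk : k ∈ inner G v u)
    (hk' : k' ∈ inner G v u) (hne : k ≠ k') : Apart G (away G k v) (away G k' v) := by
  intro x hx y hy
  refine not_adj_of_mem_comp hk'.1.ne ?_ hy.2 hy.1
  obtain ⟨b, hb, hxb⟩ := exists_pend_mem_comp hG hx
  have h1 : k' ∈ comp G k v := mem_inner_comp hk hk' hne.symm
  have h2 : k' ∉ comp G k b := fun h => hb.2 (by
    rw [← comp_eq h1, comp_eq h]; exact mem_comp_self _ _)
  have h3 := comp_subset h2 hxb
  rw [← comp_eq_of_adj hb.1 hne (hb.ne h1)] at h3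
  rwa [comp_eq (mem_inner_comp hk' hk hne)] at h3

/-- Assembling the branch of `v` at `u` from arms of the neighbours of `v` in it. -/
theorem repEnd_of_arms (hG : G.Connected) (hL : LocSep G) (hvu : G.Adj v u) (o : Dir → Option V)
    (A : Dir → Set V)
    (h1 : ∀ d k, o d = some k → k ∈ inner G v u ∧ Arm G k (A d) ∧ A d ⊆ away G k v)
    (h2 : ∀ d, o d = none → A d = ∅) (h3 : ∀ d d', d ≠ d' → Apart G (A d) (A d'))
    (h4 : ∀ k ∈ inner G v u, ∀ x ∈ away G k v, ∃ d, x ∈ A d)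
    (ho : ∀ k, o .right = some k → o .up ≠ some k ∧ o .down ≠ some k) :
    RepEnd G v (comp G v u) ∧ (o .right = none → RepMid G v (comp G v u)) := by
  have howner : ∀ d, ∀ w ∈ A d, ∃ k, o d = some k := by
    intro d w hw
    cases hd : o d with
    | none => simp [h2 d hd] at hw
    | some k => exact ⟨k, rfl⟩
  have hS : inner G v u ∪ ⋃ d, A d = comp G v u := by
    ext x
    simp only [Set.mem_union, Set.mem_iUnion]
    constructor
    · rintro (hx | ⟨d, hx⟩)
      · exact hx.2
      · obtain ⟨k, hk⟩ := howner d x hx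
        obtain ⟨hk, _, hsub⟩ := h1 d k hk
        exact away_subset hG hk (hsub hx)
    · intro hx
      exact (mem_inner_or_away hL hvu hx).imp_right fun ⟨k, hk, hxk⟩ => h4 k hk x hxk
  have hadj : ∀ w ∈ comp G v u, (G.Adj v w ↔ w ∈ inner G v u) := fun w hw =>
    ⟨fun h => ⟨h, hw⟩, fun h => h.1⟩
  obtain ⟨R, hR, hbox, hend, hmid⟩ := exists_rep_of_arms (G := G) (K := inner G v u)
    (fun k hk k' hk' hne => inner_adj hL hk hk' hne) o A ho (fun d k hk => (h1 d k hk).2.1) h2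
    (by
      intro d w hw
      obtain ⟨k, hok⟩ := howner d w hw
      obtain ⟨hk, _, hsub⟩ := h1 d k hok
      have hwk := hsub hw
      refine ⟨fun hwK => hwk.2 (mem_inner_comp hk hwK hwk.1), fun k' hk' hadj => ?_⟩
      by_cases hkk : k' = k
      · rw [hkk]; exact hok
      · exact absurd hadj (not_adj_of_mem_comp hk.1.ne (mem_inner_comp hk hk' hkk) hwk.2
          hwk.1).2)
    h3
  rw [hS] at hR hbox hend hmid
  exact ⟨⟨R, hR, hbox, fun w hw => (hadj w hw).trans (hend w hw)⟩,
    fun h => ⟨R, hR, hbox, fun w hw => (hadj w hw).trans (hmid h w hw)⟩⟩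

end Hanging

/-- The function on directions with the given values. -/
def Dir.pick {α : Type*} (x y z : α) : Dir → α
  | .up => x
  | .down => y
  | .right => z

section Assemble

variable {v u : V}

/-- The branch needs no end if only one neighbour of `v` in it is a cutpoint. -/
theorem repMid_of_one (hG : G.Connected) (hL : LocSep G) (hvu : G.Adj v u) {a : V}
    (ha : a ∈ inner G v u) {A₁ A₂ : Set V} (hA : A₁ ∪ A₂ = away G a v)
    (h12 : Apart G A₁ A₂) (h1 : Arm G a A₁) (h2 : Arm G a A₂)
    (hN : ∀ k ∈ inner G v u, (away G k v).Nonempty → k = a) : RepMid G v (comp G v u) := by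
  refine (repEnd_of_arms hG hL hvu (Dir.pick (some a) (some a) none) (Dir.pick A₁ A₂ ∅) ?_ ?_ ?_ ?_
    ?_).2 rfl
  · rintro (_ | _ | _) k hk <;> simp only [Dir.pick, Option.some.injEq, reduceCtorEq] at hk
    · subst hk; exact ⟨ha, h1, hA ▸ Set.subset_union_left⟩
    · subst hk; exact ⟨ha, h2, hA ▸ Set.subset_union_right⟩
  · rintro (_ | _ | _) hd <;> simp_all [Dir.pick]
  · rintro (_ | _ | _) (_ | _ | _) hd <;> first | exact absurd rfl hd | skip
    · exact h12
    · intro x _ y hy; exact absurd hy (Set.notMem_empty _)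
    · exact h12.symm
    · intro x _ y hy; exact absurd hy (Set.notMem_empty _)
    · intro x hx; exact absurd hx (Set.notMem_empty _)
    · intro x hx; exact absurd hx (Set.notMem_empty _)
  · intro k hk x hx
    obtain rfl := hN k hk ⟨x, hx⟩
    rw [← hA] at hx
    exact hx.elim (fun h => ⟨.up, h⟩) fun h => ⟨.down, h⟩
  · intro k hk; simp [Dir.pick] at hk

/-- The branch needs no end if two neighbours of `v` in it carry one arm each. -/
theorem repMid_of_two (hG : G.Connected) (hL : LocSep G) (hvu : G.Adj v u) {a b : V}
    (ha : a ∈ inner G v u) (hb : b ∈ inner G v u) (hab : a ≠ b)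
    (h1 : Arm G a (away G a v)) (h2 : Arm G b (away G b v))
    (hN : ∀ k ∈ inner G v u, (away G k v).Nonempty → k = a ∨ k = b) :
    RepMid G v (comp G v u) := by
  have hap := away_apart hG ha hb hab
  refine (repEnd_of_arms hG hL hvu (Dir.pick (some a) (some b) none)
    (Dir.pick (away G a v) (away G b v) ∅) ?_ ?_ ?_ ?_ ?_).2 rfl
  · rintro (_ | _ | _) k hk <;> simp only [Dir.pick, Option.some.injEq, reduceCtorEq] at hk
    · subst hk; exact ⟨ha, h1, subset_rfl⟩
    · subst hk; exact ⟨hb, h2, subset_rfl⟩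
  · rintro (_ | _ | _) hd <;> simp_all [Dir.pick]
  · rintro (_ | _ | _) (_ | _ | _) hd <;> first | exact absurd rfl hd | skip
    · exact hap
    · intro x _ y hy; exact absurd hy (Set.notMem_empty _)
    · exact hap.symm
    · intro x _ y hy; exact absurd hy (Set.notMem_empty _)
    · intro x hx; exact absurd hx (Set.notMem_empty _)
    · intro x hx; exact absurd hx (Set.notMem_empty _)
  · intro k hk x hx
    rcases hN k hk ⟨x, hx⟩ with rfl | rfl
    · exact ⟨.up, hx⟩
    · exact ⟨.down, hx⟩
  · intro k hk; simp [Dir.pick] at hk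

/-- One neighbour carries two arms, another one carries the third. -/
theorem repEnd_of_two (hG : G.Connected) (hL : LocSep G) (hvu : G.Adj v u) {a b : V}
    (ha : a ∈ inner G v u) (hb : b ∈ inner G v u) (hab : a ≠ b)
    {A₁ A₂ : Set V} (hA : A₁ ∪ A₂ = away G a v) (h12 : Apart G A₁ A₂) (h1 : Arm G a A₁)
    (h2 : Arm G a A₂) (h3 : Arm G b (away G b v))
    (hN : ∀ k ∈ inner G v u, (away G k v).Nonempty → k = a ∨ k = b) :
    RepEnd G v (comp G v u) := by
  have hap := away_apart hG ha hb hab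
  have hap1 : Apart G A₁ (away G b v) := fun x hx => hap x (hA ▸ Or.inl hx)
  have hap2 : Apart G A₂ (away G b v) := fun x hx => hap x (hA ▸ Or.inr hx)
  refine (repEnd_of_arms hG hL hvu (Dir.pick (some a) (some a) (some b))
    (Dir.pick A₁ A₂ (away G b v)) ?_ ?_ ?_ ?_ ?_).1
  · rintro (_ | _ | _) k hk <;> simp only [Dir.pick, Option.some.injEq] at hk
    · subst hk; exact ⟨ha, h1, hA ▸ Set.subset_union_left⟩
    · subst hk; exact ⟨ha, h2, hA ▸ Set.subset_union_right⟩
    · subst hk; exact ⟨hb, h3, subset_rfl⟩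
  · rintro (_ | _ | _) hd <;> simp [Dir.pick] at hd
  · rintro (_ | _ | _) (_ | _ | _) hd <;> first | exact absurd rfl hd | skip
    exacts [h12, hap1, h12.symm, hap2, hap1.symm, hap2.symm]
  · intro k hk x hx
    rcases hN k hk ⟨x, hx⟩ with rfl | rfl
    · rw [← hA] at hx
      exact hx.elim (fun h => ⟨.up, h⟩) fun h => ⟨.down, h⟩
    · exact ⟨.right, hx⟩
  · intro k hk
    simp only [Dir.pick, Option.some.injEq] at hk
    subst hk
    simpa [Dir.pick] using hab

/-- Three neighbours carry one arm each. -/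
theorem repEnd_of_three (hG : G.Connected) (hL : LocSep G) (hvu : G.Adj v u) {a b c : V}
    (ha : a ∈ inner G v u) (hb : b ∈ inner G v u)
    (hc : c ∈ inner G v u) (hab : a ≠ b) (hac : a ≠ c) (hbc : b ≠ c)
    (h1 : Arm G a (away G a v)) (h2 : Arm G b (away G b v)) (h3 : Arm G c (away G c v))
    (hN : ∀ k ∈ inner G v u, (away G k v).Nonempty → k = a ∨ k = b ∨ k = c) :
    RepEnd G v (comp G v u) := by
  have hap1 := away_apart hG ha hb hab
  have hap2 := away_apart hG ha hc hac
  have hap3 := away_apart hG hb hc hbc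
  refine (repEnd_of_arms hG hL hvu (Dir.pick (some a) (some b) (some c))
    (Dir.pick (away G a v) (away G b v) (away G c v)) ?_ ?_ ?_ ?_ ?_).1
  · rintro (_ | _ | _) k hk <;> simp only [Dir.pick, Option.some.injEq] at hk
    · subst hk; exact ⟨ha, h1, subset_rfl⟩
    · subst hk; exact ⟨hb, h2, subset_rfl⟩
    · subst hk; exact ⟨hc, h3, subset_rfl⟩
  · rintro (_ | _ | _) hd <;> simp [Dir.pick] at hd
  · rintro (_ | _ | _) (_ | _ | _) hd <;> first | exact absurd rfl hd | skip
    exacts [hap1, hap2, hap1.symm, hap3, hap2.symm, hap3.symm]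
  · intro k hk x hx
    rcases hN k hk ⟨x, hx⟩ with rfl | rfl | rfl
    · exact ⟨.up, hx⟩
    · exact ⟨.down, hx⟩
    · exact ⟨.right, hx⟩
  · intro k hk
    simp only [Dir.pick, Option.some.injEq] at hk
    subst hk
    simpa [Dir.pick] using ⟨hac, hbc⟩

end Assemble

end

section

variable {V : Type u} {G : SimpleGraph V}

/-! ### Every branch of an `𝓕`-free block graph is representable -/

theorem hasBranch_leaf_of_three {a x y z sx sy sz : V} (hax : G.Adj a x) (hay : G.Adj a y)
    (haz : G.Adj a z) (hxy : G.Adj x y) (hxz : G.Adj x z) (hyz : G.Adj y z) (hx : Pend G x a sx)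
    (hy : Pend G y a sy) (hz : Pend G z a sz) : HasBranch G a (comp G a x) .leaf := by
  refine hasBranch_leaf (c := ![x, y, z]) (s := ![sx, sy, sz]) ?_ ?_ ?_ ?_
  · intro i; fin_cases i; exacts [hax, hay, haz]
  · intro i j hij
    fin_cases i <;> fin_cases j <;> first | exact absurd rfl hij | skip
    exacts [hxy, hxz, hxy.symm, hyz, hxz.symm, hyz.symm]
  · intro i; fin_cases i; exacts [hx, hy, hz]
  · intro i; fin_cases i
    exacts [rfl, comp_eq_of_adj hxy.symm hay.ne' hax.ne', comp_eq_of_adj hxz.symm haz.ne' hax.ne']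

/-- A vertex carrying two branches of the family carries no third one. -/
theorem TwoArms.not_hasBranch (hF : IsFFree G) {a v : V} (hav : G.Adj a v)
    (h : TwoArms G a (away G a v)) {t : BranchTree} (ht : HasBranch G a (comp G a v) t) :
    False := by
  obtain ⟨_, b₁, b₂, hb₁, hb₂, h1, h2, h12, ⟨t₁, ht₁⟩, t₂, ht₂⟩ := h
  exact hF.not_three_branches ht₁ ht₂ ht (fun h => ne_of_mem_comp h1.ne' h rfl)
    (fun h => ne_of_mem_comp h2.ne' h rfl) (fun h => ne_of_mem_comp hav.ne' h rfl)
    (apart_comp h1.ne' h2.ne' h12)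
    (apart_comp h1.ne' hav.ne' fun h => hb₁.2 (mem_comp_comm.1 h))
    (apart_comp h2.ne' hav.ne' fun h => hb₂.2 (mem_comp_comm.1 h))

/-- A neighbour `a` with two branches and a neighbour `c` that is a cutpoint, all three vertices in
a common block with `v`, form a branch of the family with root `v`. -/
theorem TwoArms.hasBranch_node {a c s v : V} (hva : G.Adj v a) (hvc : G.Adj v c) (hac : G.Adj a c)
    (h : TwoArms G a (away G a v)) (hs : Pend G c v s) :
    ∃ t, HasBranch G v (comp G v a) t := by
  obtain ⟨_, b₁, b₂, hb₁, hb₂, h1, h2, h12, ⟨t₁, ht₁⟩, t₂, ht₂⟩ := h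
  exact ⟨_, BlockVPG.hasBranch_node hvc hva hac hs ⟨h1, hb₁.2⟩ ⟨h2, hb₂.2⟩ h12 ht₁ ht₂⟩

/-- The recursion on branches. The cutpoints of the block of `v` and `u` other than `v` need one or
two of the directions at the point of the block, where `v` itself leaves two or three directions
free. If three directions are needed, the branch contains a branch of the family, and if four are
needed then `G` contains a member of the family. -/
theorem attachable [Finite V] (hG : G.Connected) (hL : LocSep G) (hF : IsFFree G) :
    ∀ n v u, (comp G v u).ncard = n → G.Adj v u → (∃ v', Pend G v u v') → Attachable G v u := by
  intro n
  induction n using Nat.strong_induction_on with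
  | _ n ih =>
  rintro v u hn hvu ⟨v', hv'⟩
  have hv'K : ∀ k ∈ inner G v u, Pend G v k v' := fun k hk => ⟨hv'.1, comp_eq hk.2 ▸ hv'.2⟩
  have hcompK : ∀ k ∈ inner G v u, comp G v k = comp G v u := fun k hk => comp_eq hk.2
  -- by induction, every neighbour of `v` in the branch carries one or two arms
  have harm : ∀ a ∈ inner G v u, Arm G a (away G a v) ∨ TwoArms G a (away G a v) := by
    intro a ha
    refine arm_or_twoArms hG hF (isCompUnion_away a v) fun b hb hab => ?_
    have hvb : v ∉ comp G a b := fun h => hb.2 (mem_comp_comm.1 h)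
    refine ih _ ?_ a b rfl hab ⟨v, ha.1.symm, hvb⟩
    rw [← hn]
    exact Set.ncard_lt_ncard ⟨comp_subset_of_away ha ⟨hab, hb.2⟩,
      fun h => ne_of_mem_comp hab.ne' (h ha.2) rfl⟩
  have hpend : ∀ a, (away G a v).Nonempty → ∃ s, Pend G a v s := fun a h =>
    exists_pend_of_away hG h
  by_cases h2 : ∃ a ∈ inner G v u, TwoArms G a (away G a v)
  · obtain ⟨a, ha, hTa⟩ := h2
    obtain ⟨A₁, A₂, hA, hA12, hA1, hA2⟩ := hTa.1
    by_cases hb : ∃ b ∈ inner G v u, (away G b v).Nonempty ∧ b ≠ a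
    swap
    · push Not at hb
      exact .inl (repMid_of_one hG hL hvu ha hA hA12 hA1 hA2 hb)
    obtain ⟨b, hb, hbne, hba⟩ := hb
    obtain ⟨sb, hsb⟩ := hpend b hbne
    have hab := inner_adj hL ha hb hba.symm
    by_cases hc : ∃ c ∈ inner G v u, (away G c v).Nonempty ∧ c ≠ a ∧ c ≠ b
    · exfalso
      obtain ⟨c, hc, hcne, hca, hcb⟩ := hc
      obtain ⟨sc, hsc⟩ := hpend c hcne
      have hac := inner_adj hL ha hc hca.symm
      have hbc := inner_adj hL hb hc hcb.symm
      exact hTa.not_hasBranch hF ha.1.symm (hasBranch_leaf_of_three ha.1.symm hab hac hb.1 hc.1 hbc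
        (hv'K a ha) (hsb.of_adj ha.1 hb.1.ne hba.symm) (hsc.of_adj ha.1 hc.1.ne hca.symm))
    · push Not at hc
      refine .inr ⟨?_, ?_⟩
      · rcases harm b hb with hArm | hTb
        · exact repEnd_of_two hG hL hvu ha hb hba.symm hA hA12 hA1 hA2 hArm
            fun k hk hkne => or_iff_not_imp_left.2 fun h => hc k hk hkne h
        · exfalso
          have hTb' : TwoArms G b (away G b a) := by
            rwa [away, comp_eq_of_adj ha.1.symm hba.symm hb.1.ne]
          obtain ⟨t, ht⟩ := hTb'.hasBranch_node hab ha.1.symm hb.1.symm (hv'K a ha)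
          rw [comp_eq_of_adj hb.1.symm hba ha.1.ne] at ht
          exact hTa.not_hasBranch hF ha.1.symm ht
      · obtain ⟨t, ht⟩ := hTa.hasBranch_node ha.1 hb.1 hab hsb
        exact ⟨t, hcompK a ha ▸ ht⟩
  · push Not at h2
    have harm' : ∀ a ∈ inner G v u, Arm G a (away G a v) := fun a ha =>
      (harm a ha).resolve_right (h2 a ha)
    by_cases ha : ∃ a ∈ inner G v u, (away G a v).Nonempty
    swap
    · push Not at ha
      have hu : u ∈ inner G v u := ⟨hvu, mem_comp_self _ _⟩
      exact .inl (repMid_of_one hG hL hvu hu (Set.union_empty _)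
        (fun x _ y hy => absurd hy (Set.notMem_empty y)) (harm' u hu) (Arm.empty G u)
        fun k hk hne => absurd (ha k hk) hne.ne_empty)
    obtain ⟨a, ha, hane⟩ := ha
    by_cases hb : ∃ b ∈ inner G v u, (away G b v).Nonempty ∧ b ≠ a
    swap
    · push Not at hb
      exact .inl (repMid_of_one hG hL hvu ha (Set.union_empty _)
        (fun x _ y hy => absurd hy (Set.notMem_empty y)) (harm' a ha) (Arm.empty G a) hb)
    obtain ⟨b, hb, hbne, hba⟩ := hb
    by_cases hc : ∃ c ∈ inner G v u, (away G c v).Nonempty ∧ c ≠ a ∧ c ≠ b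
    swap
    · push Not at hc
      exact .inl (repMid_of_two hG hL hvu ha hb hba.symm (harm' a ha) (harm' b hb)
        fun k hk hkne => or_iff_not_imp_left.2 fun h => hc k hk hkne h)
    obtain ⟨c, hc, hcne, hca, hcb⟩ := hc
    obtain ⟨sa, hsa⟩ := hpend a hane
    obtain ⟨sb, hsb⟩ := hpend b hbne
    obtain ⟨sc, hsc⟩ := hpend c hcne
    have hab := inner_adj hL ha hb hba.symm
    have hac := inner_adj hL ha hc hca.symm
    have hbc := inner_adj hL hb hc hcb.symm
    by_cases hd : ∃ d ∈ inner G v u, (away G d v).Nonempty ∧ d ≠ a ∧ d ≠ b ∧ d ≠ c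
    · exfalso
      obtain ⟨d, hd, hdne, hda, hdb, hdc⟩ := hd
      obtain ⟨sd, hsd⟩ := hpend d hdne
      have hK : ∀ i, ![a, b, c, d] i ∈ inner G v u := by
        intro i; fin_cases i; exacts [ha, hb, hc, hd]
      have hs : ∀ i, Pend G (![a, b, c, d] i) v (![sa, sb, sc, sd] i) := by
        intro i; fin_cases i; exacts [hsa, hsb, hsc, hsd]
      have hne : ∀ i j, i ≠ j → ![a, b, c, d] i ≠ ![a, b, c, d] j := by
        intro i j hij
        fin_cases i <;> fin_cases j <;> first | exact absurd rfl hij | skip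
        exacts [hba.symm, hca.symm, hda.symm, hba, hcb.symm, hdb.symm, hca, hcb, hdc.symm, hda,
          hdb, hdc]
      refine hF.not_spider_five (c := Fin.cons v ![a, b, c, d])
        (s := Fin.cons v' ![sa, sb, sc, sd]) ?_ ?_
      · intro i j hij
        cases i using Fin.cases with
        | zero =>
          cases j using Fin.cases with
          | zero => exact absurd rfl hij
          | succ j => exact (hK j).1
        | succ i =>
          cases j using Fin.cases with
          | zero => exact (hK i).1.symm
          | succ j => exact inner_adj hL (hK i) (hK j) (hne i j fun h => hij (h ▸ rfl))
      · intro i j hij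
        cases i using Fin.cases with
        | zero =>
          cases j using Fin.cases with
          | zero => exact absurd rfl hij
          | succ j => exact hv'K _ (hK j)
        | succ i =>
          cases j using Fin.cases with
          | zero => exact hs i
          | succ j => exact (hs i).of_adj (hK j).1 (hK i).1.ne (hne j i fun h => hij (h ▸ rfl))
    · push Not at hd
      refine .inr ⟨repEnd_of_three hG hL hvu ha hb hc hba.symm hca.symm hcb.symm (harm' a ha)
        (harm' b hb) (harm' c hc) fun k hk hkne => ?_, .leaf, ?_⟩
      · by_contra! h
        exact h.2.2 (hd k hk hkne h.1 h.2.1)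
      · exact hcompK a ha ▸ hasBranch_leaf_of_three ha.1 hb.1 hc.1 hab hac hbc hsa hsb hsc

/-! ### Sufficiency of `𝓕`-freeness -/

/-- Without a vertex having neighbours in two components, a connected block graph is complete. -/
theorem isClique_univ_of_no_cut (hG : G.Connected) (hL : LocSep G)
    (h : ∀ r a b, G.Adj r a → G.Adj r b → b ∈ comp G r a) : G.IsClique Set.univ := by
  rintro a - b - hab
  have hr := (SimpleGraph.reachable_iff_reflTransGen _ _).1 (hG.preconnected a b)
  suffices h : b = a ∨ G.Adj a b from h.resolve_left hab.symm
  clear hab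
  induction hr with
  | refl => exact .inl rfl
  | @tail c d _ hcd ih =>
    rcases ih with rfl | hac
    · exact .inr hcd
    · exact (hL c a d hac.symm hcd (h c a d hac.symm hcd)).imp Eq.symm id

theorem IsFFree.isB0VPG [Finite V] (hG : G.Connected) (hL : LocSep G) (hF : IsFFree G) :
    IsB0VPG G := by
  -- it suffices to write the vertex set as a clique with arms up and down
  have key : ∀ (K : Set V) (o : Option V) (A₁ A₂ : Set V), G.IsClique K → K ∪ A₁ ∪ A₂ = Set.univ →
      (∀ k, o = some k → Arm G k A₁ ∧ Arm G k A₂) → (o = none → A₁ = ∅ ∧ A₂ = ∅) →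
      (∀ w ∈ A₁ ∪ A₂, w ∉ K ∧ ∀ k ∈ K, G.Adj k w → o = some k) → Apart G A₁ A₂ → IsB0VPG G := by
    intro K o A₁ A₂ hK hun h1 h2 h3 h4
    obtain ⟨R, hR, _⟩ := exists_rep_of_arms hK (Dir.pick o o none) (Dir.pick A₁ A₂ ∅)
      (by intro k hk; simp [Dir.pick] at hk)
      (by
        rintro (_ | _ | _) k hk
        · exact (h1 k hk).1
        · exact (h1 k hk).2
        · simp [Dir.pick] at hk)
      (by
        rintro (_ | _ | _) hd
        · exact (h2 hd).1
        · exact (h2 hd).2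
        · rfl)
      (by
        rintro (_ | _ | _) w hw
        · exact h3 w (.inl hw)
        · exact h3 w (.inr hw)
        · exact absurd hw (Set.notMem_empty w))
      (by
        rintro (_ | _ | _) (_ | _ | _) hd <;> first | exact absurd rfl hd | skip
        · exact h4
        · intro x _ y hy; exact absurd hy (Set.notMem_empty _)
        · exact h4.symm
        · intro x _ y hy; exact absurd hy (Set.notMem_empty _)
        · intro x hx; exact absurd hx (Set.notMem_empty _)
        · intro x hx; exact absurd hx (Set.notMem_empty _))
    have hall : ∀ w, w ∈ K ∪ ⋃ d, Dir.pick A₁ A₂ ∅ d := by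
      intro w
      have hw : w ∈ K ∪ A₁ ∪ A₂ := hun ▸ Set.mem_univ w
      rcases hw with (hw | hw) | hw
      · exact .inl hw
      · exact .inr (Set.mem_iUnion.2 ⟨.up, hw⟩)
      · exact .inr (Set.mem_iUnion.2 ⟨.down, hw⟩)
    exact isB0VPG_of_isRep_rat fun v w hvw => hR v (hall v) w (hall w) hvw
  by_cases hr : ∀ r a b, G.Adj r a → G.Adj r b → b ∈ comp G r a
  · exact key Set.univ none ∅ ∅ (isClique_univ_of_no_cut hG hL hr) (by simp) (by simp) (by simp)
      (by simp) (fun x hx => absurd hx (Set.notMem_empty x))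
  · push Not at hr
    obtain ⟨r, a, b, hra, hrb, hab⟩ := hr
    have hA : IsCompUnion G r {x | x ≠ r} := fun x hx => ⟨hx, fun y hy => ne_of_mem_comp hx hy⟩
    have hT : Arm G r {x | x ≠ r} ∨ TwoArms G r {x | x ≠ r} := by
      refine arm_or_twoArms hG hF hA fun u _ hru => attachable hG hL hF _ r u rfl hru ?_
      by_cases hau : a ∈ comp G r u
      · exact ⟨b, hrb, comp_eq hau ▸ hab⟩
      · exact ⟨a, hra, hau⟩
    have hsplit : ∃ A₁ A₂, A₁ ∪ A₂ = {x | x ≠ r} ∧ Apart G A₁ A₂ ∧ Arm G r A₁ ∧ Arm G r A₂ := by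
      rcases hT with h | h
      · exact ⟨_, ∅, Set.union_empty _, fun x _ y hy => absurd hy (Set.notMem_empty y), h,
          Arm.empty G r⟩
      · exact h.1
    obtain ⟨A₁, A₂, hun, hap, h1, h2⟩ := hsplit
    refine key {r} (some r) A₁ A₂ (by simp) ?_ ?_ (by simp) ?_ hap
    · rw [Set.union_assoc, hun]
      ext x
      simpa using em (x = r)
    · rintro k hk
      cases hk
      exact ⟨h1, h2⟩
    · intro w hw
      rw [hun] at hw
      refine ⟨hw, ?_⟩
      rintro k rfl _
      rfl

end

end BlockVPG

theorem mainTheorem2 {V : Type*} [Finite V] (G : SimpleGraph V) (hconn : G.Connected)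
    (hchordal : BlockVPG.IsChordal G) (hdiamond : BlockVPG.IsDiamondFree G) :
    BlockVPG.IsB0VPG G ↔ BlockVPG.IsFFree G :=
  ⟨BlockVPG.IsB0VPG.isFFree, BlockVPG.IsFFree.isB0VPG hconn
    (BlockVPG.locSep_of_isChordal hchordal hdiamond)⟩
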